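/- There exist a $C^\infty$ diffeomorphism $\varphi$ of the two-torus $\mathbb{T}^2=\mathbb{T}^1\times\mathbb{T}^1$, where $\mathbb{T}^1=\mathbb{R}/\mathbb{Z}$, and an irrational number $\alpha$ with the following properties. (Throughout, a topological dynamical system $(X,\varphi)$ is a compact metric space $X$ with a homeomorphism $\varphi$ of $X$.) (a) $\varphi$ is a skew product over the irrational rotation $R_\alpha:\mathbb{T}^1\to\mathbb{T}^1$, $x\mapsto x+\alpha \bmod 1$; that is, $\varphi(x,y)=(x+\alpha,\varphi_x(y))$. (b) $\varphi$ is totally strictly ergodic: for every integer $n\neq 0$, the iterate $\varphi^n$ is minimal (the only non-empty compact set $K$ with $\varphi^n(K)=K$ is $\mathbb{T}^2$) and uniquely ergodic (it has exactly one invariant Borel probability measure). Moreover, $\varphi$ is mean equicontinuous: for all $\varepsilon>0$ there is $\delta>0$ such that $d(z,w)<\delta$ implies $$\limsup_{n\to\infty}\frac1n\sum_{i=0}^{n-1}d(\varphi^i(z),\varphi^i(w))<\varepsilon .$$ The rotation $R_\alpha$ is the maximal equicontinuous factor of $\varphi$, with the projection $\pi:\mathbb{T}^2\to\mathbb{T}^1$,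 $(x,y)\mapsto x$, as factor map: $R_\alpha$ is equicontinuous, $\pi$ is a factor map (a continuous surjection with $\pi\circ\varphi=R_\alpha\circ\pi$), and for every equicontinuous factor $(Z,\rho)$ of $(\mathbb{T}^2,\varphi)$ with factor map $p$ there is a unique factor map $q$ from $(\mathbb{T}^1,R_\alpha)$ to $(Z,\rho)$ with $p=q\circ\pi$. In particular, all fibres $\pi^{-1}(x)$ of this factor map are circles, and there are no injectivity points, that is, no $z\in\mathbb{T}^2$ with $\pi^{-1}(\pi(z))=\{z\}$. (c) The unique $\varphi$-invariant Borel probability measure $\mu$ is the push-forward of the Lebesgue measure $\lambda$ on $\mathbb{T}^1$ onto a measurable graph: $\mu=(\mathrm{Id}_{\mathbb{T}^1}\times\gamma)_*\lambda$, the image of $\lambda$ under $x\mapsto(x,\gamma(x))$, for some measurable $\gamma:\mathbb{T}^1\to\mathbb{T}^1$. -/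

import Mathlib

open MeasureTheory Filter Topology
open scoped ContDiff

/-! Topological dynamical systems `(X, φ)`: a compact metric space `X` and a homeomorphism `φ`
of `X`. The `n`-th iterate is the power `φ ^ n` in the group of homeomorphisms. -/

namespace TDS

universe u

section General

variable {X : Type u} [MetricSpace X] [CompactSpace X]

/-- `φ` is minimal: the only non-empty compact `φ`-invariant subset is the whole space. -/
def IsMinimal (φ : X ≃ₜ X) : Prop :=
  ∀ K : Set X, IsCompact K → K.Nonempty → φ '' K = K → K = Set.univ

/-- `μ` is the one and only `φ`-invariant Borel probability measure. -/
def IsUniqueInvariantMeasure [MeasurableSpace X] [BorelSpace X] (φ : X ≃ₜ X) (μ : Measure X) :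
    Prop :=
  IsProbabilityMeasure μ ∧ MeasurePreserving φ μ μ ∧
    ∀ ν : Measure X, IsProbabilityMeasure ν → MeasurePreserving φ ν ν → ν = μ

/-- `φ` is uniquely ergodic: it has exactly one invariant Borel probability measure. -/
def IsUniquelyErgodic [MeasurableSpace X] [BorelSpace X] (φ : X ≃ₜ X) : Prop :=
  ∃ μ : Measure X, IsUniqueInvariantMeasure φ μ

/-- `φ` is strictly ergodic: minimal and uniquely ergodic. -/
def IsStrictlyErgodic [MeasurableSpace X] [BorelSpace X] (φ : X ≃ₜ X) : Prop :=
  IsMinimal φ ∧ IsUniquelyErgodic φ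

/-- `φ` is totally strictly ergodic: all (non-trivial) iterates of `φ` are strictly ergodic. -/
def IsTotallyStrictlyErgodic [MeasurableSpace X] [BorelSpace X] (φ : X ≃ₜ X) : Prop :=
  ∀ n : ℤ, n ≠ 0 → IsStrictlyErgodic (φ ^ n)

/-- `φ` is equicontinuous: its forward iterates are uniformly equicontinuous. -/
def IsEquicontinuous (φ : X ≃ₜ X) : Prop :=
  UniformEquicontinuous fun n : ℕ => (φ ^ n : X ≃ₜ X)

/-- The Besicovitch pseudo-metric of `φ`. The averages are bounded by the diameter of the compact
space `X`, so the upper limit in `ℝ` is the genuine one. -/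
noncomputable def besicovitchDist (φ : X ≃ₜ X) (x y : X) : ℝ :=
  limsup (fun n : ℕ => (1 / (n : ℝ)) * ∑ i ∈ Finset.range n, dist ((φ ^ i) x) ((φ ^ i) y)) atTop

/-- `φ` is mean equicontinuous. -/
def IsMeanEquicontinuous (φ : X ≃ₜ X) : Prop :=
  ∀ ε > 0, ∃ δ > 0, ∀ x y : X, dist x y < δ → besicovitchDist φ x y < ε

/-- `(Y, ψ)` is a factor of `(X, φ)` with factor map `π`. -/
structure IsFactorMap {Y : Type u} [MetricSpace Y] [CompactSpace Y]
    (φ : X ≃ₜ X) (ψ : Y ≃ₜ Y) (π : X → Y) : Prop where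
  continuous : Continuous π
  surjective : Function.Surjective π
  semiconj : π ∘ φ = ψ ∘ π

/-- `(Y, ψ, π)` is a maximal equicontinuous factor of `(X, φ)`: it is an equicontinuous factor, and
every equicontinuous factor `(Z, ρ, p)` factors through it by a unique factor map. -/
structure IsMaximalEquicontinuousFactor {Y : Type u} [MetricSpace Y] [CompactSpace Y]
    (φ : X ≃ₜ X) (ψ : Y ≃ₜ Y) (π : X → Y) : Prop where
  isFactorMap : IsFactorMap φ ψ π
  isEquicontinuous : IsEquicontinuous ψ
  existsUnique_factorMap : ∀ (Z : Type u) [MetricSpace Z] [CompactSpace Z] (ρ : Z ≃ₜ Z) (p : X → Z),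
    IsFactorMap φ ρ p → IsEquicontinuous ρ → ∃! q : Y → Z, IsFactorMap ψ ρ q ∧ p = q ∘ π

end General

/-- The circle `𝕋¹ = ℝ/ℤ`. -/
abbrev Circle1 : Type := UnitAddCircle

/-- The two-torus `𝕋² = 𝕋¹ × 𝕋¹`. -/
abbrev Torus2 : Type := Circle1 × Circle1

/-- The covering projection `ℝ² → 𝕋²`. -/
def torusProj (v : ℝ × ℝ) : Torus2 := ((v.1 : Circle1), (v.2 : Circle1))

/-- `f : 𝕋² → 𝕋²` is of class `C^∞`: it lifts to a `C^∞` map of the universal cover `ℝ²`. -/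
def IsSmoothTorusMap (f : Torus2 → Torus2) : Prop :=
  ∃ F : ℝ × ℝ → ℝ × ℝ, ContDiff ℝ ∞ F ∧ ∀ v, f (torusProj v) = torusProj (F v)

/-- `φ` is a `C^∞` diffeomorphism of the two-torus. -/
def IsSmoothTorusDiffeo (φ : Torus2 ≃ₜ Torus2) : Prop :=
  IsSmoothTorusMap φ ∧ IsSmoothTorusMap φ.symm

/-- The rotation `R_α : x ↦ x + α mod 1` of the circle. -/
noncomputable def circleRotation (α : ℝ) : Circle1 ≃ₜ Circle1 :=
  Homeomorph.addRight (α : Circle1)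

/-- `φ` is a skew product over `g`: it has the form `(x, y) ↦ (g x, φ_x y)`. -/
def IsSkewProductOver (φ : Torus2 ≃ₜ Torus2) (g : Circle1 ≃ₜ Circle1) : Prop :=
  ∃ fib : Circle1 → Circle1 → Circle1, ∀ x y : Circle1, φ (x, y) = (g x, fib x y)

end TDS

/-!
The diffeomorphism is built by fast approximation by conjugation (Anosov–Katok), with all conjugacies
acting on the fibres only. It is the limit of maps `φₙ = Dₙ ∘ (R_{αₙ} × id) ∘ Dₙ⁻¹`, where `αₙ` is
rational and `Dₙ₊₁ = Dₙ ∘ T`. The twist `T` acts on the fibre over `x` by a strongly hyperbolic Möbius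
map with attractor `Q x` and repeller `Q x + 1 / 2`. If `Q αₙ` is an integer, `T` commutes with the
rotation by `αₙ`, so replacing `Dₙ` by `Dₙ₊₁` does not change `φₙ`, and `φₙ₊₁` is as close to `φₙ` as
desired in every `C^k` norm once `αₙ₊₁ = αₙ + 1 / (Q m)` with `m` large (`Stage.exists_next`).

An orbit of `φₙ₊₁` is, in the coordinates given by `Dₙ`, close to the curve `y = Q x` except when the
repeller passes by, which is rare. So it stays close on average to the graph of
`gₙ : x ↦ Dₙ (x, Q x)`, uniformly in the initial point (`FibreDiffeo.sum_dist_graph_le`). This is a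
finite-time open condition, which the limit `φ` inherits, and for `Q` large the graph of `gₙ` is nearly
dense in the torus. This is the property `HasDenseTrackingGraphs`, from which all the dynamics
follows:

* two graphs which track the same orbits are close in `L¹`, so `gₙ` converges almost everywhere to a
  measurable `γ`; its graph is invariant, and every invariant measure of an iterate is carried by it
  and projects to Lebesgue measure (`exists_graph_measure`);
* a closed set invariant under an iterate is close to the graphs of `gₙ` on average, and these are
  dense (`isMinimal_pow`);
* two orbits over nearby points of the base are both close to one continuous graph on average
  (`besicovitchDist_le`); in particular points in one fibre are proximal, so that equicontinuous
  factors, which are distal, identify them (`isMaximalEquicontinuousFactor_of_tracking`).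
-/

namespace TDS

/-! ### Graphs tracked in the mean -/

/-- The continuous graph of `g` tracks `φ` in the mean up to `ε`: there is a time `N` such that, over
the first `N` steps of any orbit, the mean vertical distance to the graph is at most `ε`. -/
def IsTrackedBy (φ : Torus2 ≃ₜ Torus2) (g : C(Circle1, Circle1)) (ε : ℝ) : Prop :=
  ∃ N : ℕ, 0 < N ∧ ∀ z : Torus2,
    ∑ i ∈ Finset.range N, dist ((φ ^ i) z).2 (g ((φ ^ i) z).1) ≤ N * ε

/-- `φ` is tracked in the mean by graphs `g` that are `r`-dense in the torus for every `r`. The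
density is quantitative: the graph spends in each `r`-ball a time that exceeds the tracking
error `ε` by the factor `1 / r`. -/
def HasDenseTrackingGraphs (φ : Torus2 ≃ₜ Torus2) : Prop :=
  ∀ r > 0, ∃ (g : C(Circle1, Circle1)) (ε : ℝ), 0 < ε ∧ IsTrackedBy φ g ε ∧
    ∀ z : Torus2, ε ≤ r * volume.real {x : Circle1 | dist (x, g x) z < r}

lemma sum_range_mul_eq {α : Type*} [AddCommMonoid α] (f : ℕ → α) (m n : ℕ) :
    ∑ i ∈ Finset.range (m * n), f i =
      ∑ j ∈ Finset.range m, ∑ i ∈ Finset.range n, f (n * j + i) := by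
  induction m with
  | zero => simp
  | succ m ih => rw [Nat.succ_mul, Finset.sum_range_add, ih, Finset.sum_range_succ, mul_comm m n]

section Tracking

variable {φ : Torus2 ≃ₜ Torus2} {g g' : C(Circle1, Circle1)} {ε ε' : ℝ} {β : Circle1}

/-- A tracking time may be replaced by any multiple of it. -/
lemma sum_range_mul_le {N : ℕ}
    (h : ∀ z, ∑ i ∈ Finset.range N, dist ((φ ^ i) z).2 (g ((φ ^ i) z).1) ≤ N * ε) (m : ℕ)
    (z : Torus2) :
    ∑ i ∈ Finset.range (m * N), dist ((φ ^ i) z).2 (g ((φ ^ i) z).1) ≤ (m * N : ℕ) * ε := by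
  rw [sum_range_mul_eq]
  calc _ ≤ ∑ j ∈ Finset.range m, (N * ε) := by
        refine Finset.sum_le_sum fun j _ => ?_
        simpa [pow_add, add_comm (N * j), Homeomorph.mul_apply] using h ((φ ^ (N * j)) z)
    _ = _ := by simp [mul_assoc]

lemma IsTrackedBy.pow (h : IsTrackedBy φ g ε) {k : ℕ} (hk : 0 < k) :
    IsTrackedBy (φ ^ k) g (k * ε) := by
  obtain ⟨N, hN, h⟩ := h
  refine ⟨N, hN, fun z => ?_⟩
  have h1 := sum_range_mul_le h k z
  rw [mul_comm k N, sum_range_mul_eq] at h1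
  calc _ ≤ _ := Finset.sum_le_sum fun i _ => ?_
    _ ≤ _ := h1
    _ = _ := by push_cast; ring
  have := Finset.single_le_sum
    (f := fun l => dist ((φ ^ (k * i + l)) z).2 (g ((φ ^ (k * i + l)) z).1))
    (fun _ _ => dist_nonneg) (Finset.mem_range.2 hk)
  simpa [pow_mul] using this

lemma IsTrackedBy.nonneg (h : IsTrackedBy φ g ε) : 0 ≤ ε := by
  obtain ⟨N, hN, h⟩ := h
  have h1 := h 0
  have h2 : 0 ≤ N * ε := le_trans (Finset.sum_nonneg fun _ _ => dist_nonneg) h1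
  have : (0 : ℝ) < N := by exact_mod_cast hN
  exact nonneg_of_mul_nonneg_right h2 this

lemma pow_fst (hβ : ∀ z, (φ z).1 = z.1 + β) (n : ℕ) (z : Torus2) :
    ((φ ^ n) z).1 = z.1 + n • β := by
  induction n generalizing z with
  | zero => simp
  | succ n ih => rw [pow_succ, Homeomorph.mul_apply, ih, hβ, succ_nsmul', add_assoc]

lemma integrable_of_continuous {X : Type*} [TopologicalSpace X] [CompactSpace X]
    [MeasurableSpace X] [OpensMeasurableSpace X] {μ : Measure X} [IsFiniteMeasure μ]
    {f : X → ℝ} (hf : Continuous f) : Integrable f μ :=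
  (BoundedContinuousFunction.mkOfCompact ⟨f, hf⟩).integrable μ

lemma homeomorph_pow_apply {X : Type*} [TopologicalSpace X] (φ : X ≃ₜ X) (n : ℕ) (x : X) :
    (φ ^ n) x = φ^[n] x := by
  induction n generalizing x with
  | zero => rfl
  | succ n ih => rw [pow_succ, Homeomorph.mul_apply, ih, Function.iterate_succ_apply]

lemma measurePreserving_pow {X : Type*} [TopologicalSpace X] [MeasurableSpace X] {ψ : X ≃ₜ X}
    {ν : Measure X} (h : MeasurePreserving ψ ν ν) (n : ℕ) : MeasurePreserving (ψ ^ n) ν ν := by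
  have : ⇑(ψ ^ n) = ψ^[n] := funext (homeomorph_pow_apply ψ n)
  rw [this]
  exact h.iterate n

/-- The mean of a function over a segment of orbits, bounded uniformly, bounds the integral against
invariant measures. -/
lemma integral_le_of_sum_le {X : Type*} [TopologicalSpace X] [CompactSpace X]
    [MeasurableSpace X] [BorelSpace X] {ψ : X ≃ₜ X} {ν : Measure X} [IsProbabilityMeasure ν]
    (h : MeasurePreserving ψ ν ν) {f : X → ℝ} (hf : Continuous f) {N : ℕ} (hN : 0 < N) {C : ℝ}
    (hs : ∀ x, ∑ i ∈ Finset.range N, f ((ψ ^ i) x) ≤ N * C) : ∫ x, f x ∂ν ≤ C := by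
  have h1 : ∀ i : ℕ, ∫ x, f ((ψ ^ i) x) ∂ν = ∫ x, f x ∂ν := fun i =>
    (measurePreserving_pow h i).integral_comp (ψ ^ i).measurableEmbedding f
  have h2 : ∫ x, ∑ i ∈ Finset.range N, f ((ψ ^ i) x) ∂ν ≤ ∫ _, (N * C) ∂ν :=
    integral_mono (integrable_of_continuous (by fun_prop)) (integrable_const _) hs
  rw [integral_finsetSum _ fun i _ => integrable_of_continuous (by fun_prop)] at h2
  simp only [h1, Finset.sum_const, Finset.card_range, nsmul_eq_mul, integral_const,
    probReal_univ, smul_eq_mul, one_mul] at h2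
  exact le_of_mul_le_mul_left h2 (by exact_mod_cast hN)

lemma addRight_pow_apply (β : Circle1) (i : ℕ) (x : Circle1) :
    ((Homeomorph.addRight β) ^ i) x = x + i • β := by
  induction i generalizing x with
  | zero => simp
  | succ n ih => rw [pow_succ, Homeomorph.mul_apply, ih, succ_nsmul', ← add_assoc]; rfl

instance : IsProbabilityMeasure (volume : Measure Circle1) := ⟨by simp⟩

/-- The bound of means along orbits of a rotation, for Lebesgue measure. -/
lemma integral_le_of_sum_add_le {f : Circle1 → ℝ} (hf : Continuous f) {N : ℕ} (hN : 0 < N) {C : ℝ}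
    (β : Circle1) (hs : ∀ x, ∑ i ∈ Finset.range N, f (x + i • β) ≤ N * C) :
    ∫ x, f x ≤ C :=
  integral_le_of_sum_le (ψ := Homeomorph.addRight β) (measurePreserving_add_right volume β) hf hN
    (by simpa only [addRight_pow_apply] using hs)

lemma IsTrackedBy.integral_dist_le (h : IsTrackedBy φ g ε) {ν : Measure Torus2}
    [IsProbabilityMeasure ν] (hν : MeasurePreserving φ ν ν) :
    ∫ z, dist z.2 (g z.1) ∂ν ≤ ε := by
  obtain ⟨N, hN, h⟩ := h
  exact integral_le_of_sum_le hν (by fun_prop) hN h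

lemma IsTrackedBy.integral_dist_graphs_le (hβ : ∀ z, (φ z).1 = z.1 + β)
    (h : IsTrackedBy φ g ε) (h' : IsTrackedBy φ g' ε') :
    ∫ x, dist (g x) (g' x) ≤ ε + ε' := by
  obtain ⟨N, hN, h⟩ := h
  obtain ⟨N', hN', h'⟩ := h'
  refine integral_le_of_sum_add_le (by fun_prop) (Nat.mul_pos hN' hN) β fun x => ?_
  have h1 := sum_range_mul_le h N' (x, 0)
  have h2 := sum_range_mul_le h' N (x, 0)
  rw [mul_comm N N'] at h2
  rw [mul_add]
  refine le_trans ?_ (add_le_add h1 h2)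
  rw [← Finset.sum_add_distrib]
  refine Finset.sum_le_sum fun i _ => ?_
  simp only [pow_fst hβ]
  exact dist_triangle_left _ _ _

/-- If the fibre maps satisfy `d (φ z) (φ w) ≤ η + C d(z, w)`, the graph of `g` is invariant up to an
error controlled by the tracking error. -/
lemma IsTrackedBy.integral_dist_image_le (hβ : ∀ z, (φ z).1 = z.1 + β)
    (h : IsTrackedBy φ g ε) {η C : ℝ} (hC : 0 ≤ C)
    (hφ : ∀ z w, dist (φ z) (φ w) ≤ η + C * dist z w) :
    ∫ x, dist (φ (x, g x)).2 (g (x + β)) ≤ η + C * ε + ε := by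
  obtain ⟨N, hN, h⟩ := h
  refine integral_le_of_sum_add_le (by fun_prop) hN β fun x => ?_
  have h1 := h (x, 0)
  have h2 := h (φ (x, 0))
  calc _ ≤ ∑ i ∈ Finset.range N, ((η + C * dist ((φ ^ i) (x, 0)).2 (g ((φ ^ i) (x, 0)).1)) +
        dist ((φ ^ i) (φ (x, 0))).2 (g ((φ ^ i) (φ (x, 0))).1)) := Finset.sum_le_sum fun i _ => ?_
    _ ≤ N * η + C * (N * ε) + N * ε := by
        rw [Finset.sum_add_distrib, Finset.sum_add_distrib, ← Finset.mul_sum]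
        simp only [Finset.sum_const, Finset.card_range, nsmul_eq_mul]
        gcongr
    _ = _ := by ring
  have e1 : (φ ^ i) (φ (x, 0)) = φ ((φ ^ i) (x, 0)) := by
    rw [← Homeomorph.mul_apply, ← Homeomorph.mul_apply, ← pow_succ, ← pow_succ']
  rw [e1, hβ, pow_fst hβ]
  set z := (φ ^ i) (x, 0) with hz
  have e2 : x + i • β = z.1 := by rw [hz, pow_fst hβ]
  simp only [e2]
  refine le_trans (dist_triangle _ (φ z).2 _) (add_le_add_left ?_ _)
  have h3 : dist ((φ (z.1, g z.1)).2) (φ z).2 ≤ dist (φ (z.1, g z.1)) (φ z) := le_max_right _ _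
  refine h3.trans ((hφ _ _).trans ?_)
  have h4 : dist (z.1, g z.1) z = dist z.2 (g z.1) := by
    rw [Prod.dist_eq, dist_self, dist_comm, max_eq_right dist_nonneg]
  rw [h4]

/-- A closed invariant set that meets every fibre is close, on average, to tracking graphs. -/
lemma IsTrackedBy.integral_infDist_le (hβ : ∀ z, (φ z).1 = z.1 + β)
    (h : IsTrackedBy φ g ε) {K : Set Torus2} (hK : φ '' K = K) (hK' : Prod.fst '' K = Set.univ) :
    ∫ x, Metric.infDist (x, g x) K ≤ ε := by
  obtain ⟨N, hN, h⟩ := h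
  refine integral_le_of_sum_add_le
    ((Metric.continuous_infDist_pt K).comp (by fun_prop)) hN β fun x => ?_
  obtain ⟨z, hz, rfl⟩ : x ∈ Prod.fst '' K := hK' ▸ Set.mem_univ x
  refine le_trans (Finset.sum_le_sum fun i _ => ?_) (h z)
  have h1 : (φ ^ i) z ∈ K := by
    clear * - hz hK
    induction i with
    | zero => exact hz
    | succ i ih =>
      rw [pow_succ', Homeomorph.mul_apply]
      exact hK ▸ Set.mem_image_of_mem φ ih
  rw [← pow_fst hβ]
  refine (Metric.infDist_le_dist_of_mem h1).trans ?_
  rw [Prod.dist_eq, dist_self, dist_comm, max_eq_right dist_nonneg]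

end Tracking

/-! ### Irrational rotations -/

lemma denseRange_nsmul_zsmul {α : ℝ} (hα : Irrational α) {k : ℕ} (hk : 0 < k) :
    DenseRange (fun n : ℤ => n • (k • (α : Circle1))) := by
  have : k • (α : Circle1) = ((k * α : ℝ) : Circle1) := by simp
  rw [this]
  refine AddCircle.denseRange_zsmul_coe_iff.2 ?_
  rw [div_one]
  exact hα.natCast_mul hk.ne'

lemma fst_image_eq_univ {φ : Torus2 ≃ₜ Torus2} {β : Circle1} (hβ : ∀ z, (φ z).1 = z.1 + β)
    (hd : DenseRange (fun n : ℤ => n • β)) {K : Set Torus2} (hK : IsCompact K) (hne : K.Nonempty)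
    (hKφ : φ '' K = K) : Prod.fst '' K = Set.univ := by
  have h1 : ∀ x ∈ Prod.fst '' K, ∀ n : ℤ, x + n • β ∈ Prod.fst '' K := by
    have hp : ∀ x ∈ Prod.fst '' K, x + β ∈ Prod.fst '' K := by
      rintro _ ⟨z, hz, rfl⟩
      exact ⟨φ z, hKφ ▸ Set.mem_image_of_mem φ hz, hβ z⟩
    have hm : ∀ x ∈ Prod.fst '' K, x - β ∈ Prod.fst '' K := by
      rintro _ ⟨z, hz, rfl⟩
      rw [← hKφ] at hz
      obtain ⟨w, hw, rfl⟩ := hz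
      exact ⟨w, hw, by rw [hβ, add_sub_cancel_right]⟩
    intro x hx n
    induction n with
    | zero => simpa using hx
    | succ n ih => rw [add_zsmul, one_zsmul, ← add_assoc]; exact hp _ ih
    | pred n ih => rw [sub_zsmul, one_zsmul, ← sub_eq_add_neg, ← add_sub_assoc]; exact hm _ ih
  obtain ⟨z, hz⟩ := hne
  have h2 : IsClosed (Prod.fst '' K) := (hK.image continuous_fst).isClosed
  have h3 : Dense (Set.range fun n : ℤ => z.1 + n • β) :=
    ((Homeomorph.addLeft z.1).surjective.denseRange.comp hd (Homeomorph.addLeft z.1).continuous :)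
  refine Set.eq_univ_of_univ_subset ?_
  rw [← h3.closure_eq]
  refine h2.closure_subset_iff.2 ?_
  rintro _ ⟨n, rfl⟩
  exact h1 _ ⟨z, hz, rfl⟩ n

/-- Irrational rotations are uniquely ergodic. -/
lemma eq_volume_of_measurePreserving {β : Circle1} (hd : DenseRange (fun n : ℤ => n • β))
    {ν : Measure Circle1} [IsProbabilityMeasure ν] (h : MeasurePreserving (· + β) ν ν) :
    ν = volume := by
  have hz : ∀ f : BoundedContinuousFunction Circle1 ℝ, ∀ n : ℤ,
      ∫ x, f (x + n • β) ∂ν = ∫ x, f x ∂ν := by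
    intro f n
    have hp : ∀ y : Circle1, ∫ x, f (x + β + y) ∂ν = ∫ x, f (x + y) ∂ν := fun y =>
      h.integral_comp (Homeomorph.addRight β).measurableEmbedding (fun x => f (x + y))
    induction n with
    | zero => simp
    | succ n ih =>
      refine Eq.trans ?_ ((hp _).trans ih)
      congr with x
      rw [add_zsmul, one_zsmul, add_comm _ β, add_assoc]
    | pred n ih =>
      refine (hp _).symm.trans (Eq.trans ?_ ih)
      congr with x
      rw [sub_zsmul, one_zsmul]
      congr 1
      abel
  have ha : ∀ f : BoundedContinuousFunction Circle1 ℝ, ∀ y : Circle1,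
      ∫ x, f (x + y) ∂ν = ∫ x, f x ∂ν := by
    intro f
    have hc : Continuous fun y : Circle1 => ∫ x, f (x + y) ∂ν :=
      continuous_of_dominated (bound := fun _ => ‖f‖)
        (fun y => (by fun_prop : Continuous fun x => f (x + y)).aestronglyMeasurable)
        (fun y => ae_of_all _ fun x => f.norm_coe_le_norm _) (integrable_const _)
        (ae_of_all _ fun x => by fun_prop)
    exact fun y => congrFun (hd.equalizer hc continuous_const (funext fun n => hz f n)) y
  have hinv : ν.IsAddLeftInvariant := by
    constructor
    intro y
    have : IsFiniteMeasure (ν.map (y + ·)) := Measure.isFiniteMeasure_map _ _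
    refine ext_of_forall_integral_eq_of_IsFiniteMeasure fun f => ?_
    rw [integral_map (by fun_prop) (by fun_prop), ← ha f y]
    simp only [add_comm]
  have : ν.IsAddHaarMeasure :=
    Measure.isAddHaarMeasure_of_isCompact_nonempty_interior ν Set.univ isCompact_univ (by simp)
      (by simp) (by simp)
  exact Measure.isAddHaarMeasure_eq_of_isProbabilityMeasure ν volume

/-! ### Total strict ergodicity and the graph measure -/

section Ergodicity

variable {φ : Torus2 ≃ₜ Torus2} {α : ℝ}

lemma isMinimal_pow (hβ : ∀ z, (φ z).1 = z.1 + (α : Circle1)) (hα : Irrational α)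
    (h : HasDenseTrackingGraphs φ) {k : ℕ} (hk : 0 < k) : IsMinimal (φ ^ k) := by
  intro K hKc hne hK
  refine Set.eq_univ_of_forall fun z => ?_
  by_contra hz
  have hfst := fst_image_eq_univ (pow_fst hβ k) (denseRange_nsmul_zsmul hα hk) hKc hne hK
  set d := Metric.infDist z K with hd
  have hd0 : 0 < d := (hKc.isClosed.notMem_iff_infDist_pos hne).1 hz
  set r := d / (k + 2) with hr
  have hr0 : 0 < r := by positivity
  have hdr : d = r * (k + 2) := by rw [hr]; field_simp
  obtain ⟨g, ε, hε, hg, hgr⟩ := h r hr0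
  have h1 := (hg.pow hk).integral_infDist_le (pow_fst hβ k) hK hfst
  have hc : Continuous fun x : Circle1 => Metric.infDist (x, g x) K :=
    (Metric.continuous_infDist_pt K).comp (by fun_prop)
  have h2 := mul_meas_ge_le_integral_of_nonneg (μ := (volume : Measure Circle1))
    (ae_of_all _ fun x : Circle1 => Metric.infDist_nonneg (x := (x, g x)) (s := K))
    (integrable_of_continuous hc) (d - r)
  have h3 : {x : Circle1 | dist (x, g x) z < r} ⊆ {x | d - r ≤ Metric.infDist (x, g x) K} := by
    intro x hx
    have := Metric.infDist_le_infDist_add_dist (s := K) (x := z) (y := (x, g x))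
    rw [dist_comm] at this
    simp only [Set.mem_ofPred_eq] at hx ⊢
    linarith
  have h4 := measureReal_mono (μ := (volume : Measure Circle1)) h3
  have h5 := hgr z
  set c := volume.real {x : Circle1 | dist (x, g x) z < r}
  have hc0 : 0 < c := by
    by_contra hc0
    nlinarith
  have h6 : (d - r) * c ≤ k * ε := (mul_le_mul_of_nonneg_left h4 (by
    rw [hdr]; nlinarith [(Nat.cast_nonneg k : (0 : ℝ) ≤ k)])).trans (h2.trans h1)
  have h7 : (k : ℝ) * ε ≤ k * (r * c) := by gcongr
  rw [hdr] at h6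
  nlinarith [mul_pos hr0 hc0]

/-- The tracking graphs converge in measure to a measurable graph. -/
lemma exists_tendsto_tracking_graphs (hβ : ∀ z, (φ z).1 = z.1 + (α : Circle1))
    (h : HasDenseTrackingGraphs φ) :
    ∃ (g : ℕ → C(Circle1, Circle1)) (ε : ℕ → ℝ) (γ : Circle1 → Circle1), Measurable γ ∧
      (∀ n, IsTrackedBy φ (g n) (ε n)) ∧ Tendsto ε atTop (𝓝 0) ∧
      ∀ᵐ x : Circle1, Tendsto (fun n => g n x) atTop (𝓝 (γ x)) := by
  choose g ε hε hg hgr using fun n : ℕ => h ((1 / 2 : ℝ) ^ n) (by positivity)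
  have hε1 : ∀ n, ε n ≤ (1 / 2) ^ n := fun n =>
    (hgr n 0).trans (mul_le_of_le_one_right (by positivity) measureReal_le_one)
  have hε0 : Tendsto ε atTop (𝓝 0) :=
    squeeze_zero (fun n => (hε n).le) hε1
      (tendsto_pow_atTop_nhds_zero_of_lt_one (by norm_num) (by norm_num))
  have hsum : ∑' n, ∫⁻ x : Circle1, edist (g n x) (g (n + 1) x) ≠ ⊤ := by
    have hle : ∀ n, ∫⁻ x : Circle1, edist (g n x) (g (n + 1) x) ≤
        ENNReal.ofReal (2 * (1 / 2) ^ n) := by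
      intro n
      simp_rw [edist_dist]
      rw [← ofReal_integral_eq_lintegral_ofReal (integrable_of_continuous (by fun_prop))
        (ae_of_all _ fun _ => dist_nonneg)]
      refine ENNReal.ofReal_le_ofReal (((hg n).integral_dist_graphs_le hβ (hg (n + 1))).trans ?_)
      have h1 := hε1 n
      have h2 := hε1 (n + 1)
      have h3 : (0 : ℝ) < (1 / 2) ^ n := by positivity
      rw [pow_succ] at h2
      linarith
    refine ne_top_of_le_ne_top ?_ (ENNReal.tsum_le_tsum hle)
    have hs : Summable fun n : ℕ => 2 * (1 / 2 : ℝ) ^ n := summable_geometric_two.mul_left 2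
    rw [← ENNReal.ofReal_tsum_of_nonneg (fun n => by positivity) hs]
    exact ENNReal.ofReal_ne_top
  have hlim : ∀ᵐ x : Circle1, ∃ y, Tendsto (fun n => g n x) atTop (𝓝 y) := by
    rw [← lintegral_tsum fun n =>
      (by fun_prop : Continuous fun x => edist (g n x) (g (n + 1) x)).aemeasurable] at hsum
    filter_upwards [ae_lt_top' (AEMeasurable.tsum fun n =>
      (by fun_prop : Continuous fun x => edist (g n x) (g (n + 1) x)).aemeasurable) hsum]
      with x hx
    exact cauchySeq_tendsto_of_complete (cauchySeq_of_edist_le_of_tsum_ne_top _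
      (fun n => le_rfl) hx.ne)
  obtain ⟨γ, hγ, hlim⟩ := measurable_limit_of_tendsto_metrizable_ae
    (fun n => (g n).continuous.aemeasurable) hlim
  exact ⟨g, ε, γ, hγ, hg, hε0, hlim⟩

lemma circle_dist_le_one (x y : Circle1) : dist x y ≤ 1 := by
  rw [dist_eq_norm]
  refine (AddCircle.norm_le_half_period 1 one_ne_zero).trans ?_
  norm_num

/-- A continuous self-map of a compact space is Lipschitz up to a small additive error. -/
lemma exists_dist_le_add_mul {X Y : Type*} [PseudoMetricSpace X] [CompactSpace X]
    [PseudoMetricSpace Y] [CompactSpace Y] {f : X → Y} (hf : Continuous f) {η : ℝ} (hη : 0 < η) :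
    ∃ C, 0 ≤ C ∧ ∀ z w, dist (f z) (f w) ≤ η + C * dist z w := by
  obtain ⟨δ, hδ, h⟩ := Metric.uniformContinuous_iff.1
    (CompactSpace.uniformContinuous_of_continuous hf) η hη
  have hb : Bornology.IsBounded (Set.univ : Set Y) := isCompact_univ.isBounded
  refine ⟨Metric.diam (Set.univ : Set Y) / δ, by positivity, fun z w => ?_⟩
  rcases lt_or_ge (dist z w) δ with hzw | hzw
  · have := h hzw
    have : 0 ≤ Metric.diam (Set.univ : Set Y) / δ * dist z w := by positivity
    linarith
  · have h1 : dist (f z) (f w) ≤ Metric.diam (Set.univ : Set Y) :=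
      Metric.dist_le_diam_of_mem hb trivial trivial
    have h2 : Metric.diam (Set.univ : Set Y) ≤ Metric.diam (Set.univ : Set Y) / δ * dist z w := by
      rw [div_mul_eq_mul_div, le_div_iff₀ hδ]
      gcongr
    linarith

lemma measurePreserving_fst {ψ : Torus2 ≃ₜ Torus2} {β : Circle1}
    (hβ : ∀ z, (ψ z).1 = z.1 + β) (hd : DenseRange (fun n : ℤ => n • β)) {ν : Measure Torus2}
    [IsProbabilityMeasure ν] (hν : MeasurePreserving ψ ν ν) :
    MeasurePreserving Prod.fst ν volume := by
  refine ⟨measurable_fst, ?_⟩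
  have : IsProbabilityMeasure (ν.map Prod.fst) :=
    Measure.isProbabilityMeasure_map measurable_fst.aemeasurable
  refine eq_volume_of_measurePreserving hd ⟨by fun_prop, ?_⟩
  rw [Measure.map_map (by fun_prop) measurable_fst]
  have : (fun x => x + β) ∘ Prod.fst = Prod.fst ∘ ψ := funext fun z => (hβ z).symm
  rw [this, ← Measure.map_map measurable_fst ψ.continuous.measurable, hν.map_eq]

lemma integral_dist_tendsto_zero {X : Type*} [MeasurableSpace X] {μ : Measure X}
    [IsFiniteMeasure μ] {u v : ℕ → X → Circle1} {a b : X → Circle1}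
    (hu : ∀ n, Measurable (u n)) (hv : ∀ n, Measurable (v n))
    (hua : ∀ᵐ x ∂μ, Tendsto (fun n => u n x) atTop (𝓝 (a x)))
    (hvb : ∀ᵐ x ∂μ, Tendsto (fun n => v n x) atTop (𝓝 (b x))) :
    Tendsto (fun n => ∫ x, dist (u n x) (v n x) ∂μ) atTop (𝓝 (∫ x, dist (a x) (b x) ∂μ)) := by
  refine tendsto_integral_of_dominated_convergence (fun _ => 1)
    (fun n => ((hu n).dist (hv n)).aestronglyMeasurable) (integrable_const _)
    (fun n => ae_of_all _ fun x => ?_) ?_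
  · rw [Real.norm_of_nonneg dist_nonneg]
    exact circle_dist_le_one _ _
  · filter_upwards [hua, hvb] with x h1 h2 using h1.dist h2

lemma ae_eq_of_integral_dist_nonpos {X : Type*} [MeasurableSpace X] {μ : Measure X}
    [IsFiniteMeasure μ] {a b : X → Circle1} (ha : Measurable a) (hb : Measurable b)
    (h : ∫ x, dist (a x) (b x) ∂μ ≤ 0) : a =ᵐ[μ] b := by
  have hi : Integrable (fun x => dist (a x) (b x)) μ :=
    Integrable.of_bound (ha.dist hb).aestronglyMeasurable 1 (ae_of_all _ fun x => by
      rw [Real.norm_of_nonneg dist_nonneg]; exact circle_dist_le_one _ _)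
  have h0 := (integral_eq_zero_iff_of_nonneg (fun x => dist_nonneg) hi).1
    (le_antisymm h (integral_nonneg fun _ => dist_nonneg))
  filter_upwards [h0] with x hx using dist_eq_zero.1 hx

lemma ae_add_right {p : Circle1 → Prop} (β : Circle1) (h : ∀ᵐ x, p x) : ∀ᵐ x, p (x + β) := by
  have hq : Measure.QuasiMeasurePreserving (fun x : Circle1 => x + β) volume volume :=
    (measurePreserving_add_right volume β).quasiMeasurePreserving
  exact hq.ae h

/-- The limit of the tracking graphs is invariant. -/
lemma graph_limit_ae_invariant (hβ : ∀ z, (φ z).1 = z.1 + (α : Circle1))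
    {g : ℕ → C(Circle1, Circle1)} {ε : ℕ → ℝ} {γ : Circle1 → Circle1} (hγ : Measurable γ)
    (hg : ∀ n, IsTrackedBy φ (g n) (ε n)) (hε : Tendsto ε atTop (𝓝 0))
    (hlim : ∀ᵐ x : Circle1, Tendsto (fun n => g n x) atTop (𝓝 (γ x))) :
    ∀ᵐ x : Circle1, (φ (x, γ x)).2 = γ (x + α) := by
  have hm : Measurable fun x : Circle1 => (φ (x, γ x)).2 :=
    measurable_snd.comp (φ.continuous.measurable.comp (measurable_id.prodMk hγ))
  have hm' : Measurable fun x : Circle1 => γ (x + α) := hγ.comp (measurable_add_const _)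
  refine ae_eq_of_integral_dist_nonpos hm hm' ?_
  have hlim' : ∀ᵐ x : Circle1, Tendsto (fun n => g n (x + α)) atTop (𝓝 (γ (x + α))) :=
    ae_add_right (p := fun x => Tendsto (fun n => g n x) atTop (𝓝 (γ x))) (α : Circle1) hlim
  have hlim'' : ∀ᵐ x : Circle1,
      Tendsto (fun n => (φ (x, g n x)).2) atTop (𝓝 (φ (x, γ x)).2) := by
    filter_upwards [hlim] with x hx
    have hc : Continuous fun y => (φ (x, y)).2 := by fun_prop
    exact (hc.tendsto (γ x)).comp hx
  have hc1 : ∀ n, Continuous fun x : Circle1 => (φ (x, g n x)).2 := fun n => by fun_prop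
  have hc2 : ∀ n, Continuous fun x : Circle1 => g n (x + α) := fun n => by fun_prop
  have ht : Tendsto (fun n => ∫ x, dist (φ (x, g n x)).2 (g n (x + α))) atTop
      (𝓝 (∫ x : Circle1, dist (φ (x, γ x)).2 (γ (x + α)))) := integral_dist_tendsto_zero
    (fun n => (hc1 n).measurable) (fun n => (hc2 n).measurable) hlim'' hlim'
  refine le_of_forall_pos_le_add fun η hη => ?_
  obtain ⟨C, hC, hφ⟩ := exists_dist_le_add_mul φ.continuous hη
  have hb : Tendsto (fun n => η + C * ε n + ε n) atTop (𝓝 (η + C * 0 + 0)) :=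
    ((hε.const_mul C).const_add η).add hε
  have := le_of_tendsto_of_tendsto' ht hb fun n => (hg n).integral_dist_image_le hβ hC hφ
  linarith

/-- Invariant measures of iterates of `φ` live on the limit of the tracking graphs. -/
lemma ae_mem_graph_limit {g : ℕ → C(Circle1, Circle1)} {ε : ℕ → ℝ} {γ : Circle1 → Circle1}
    (hγ : Measurable γ) (hg : ∀ n, IsTrackedBy φ (g n) (ε n)) (hε : Tendsto ε atTop (𝓝 0))
    (hlim : ∀ᵐ x : Circle1, Tendsto (fun n => g n x) atTop (𝓝 (γ x)))
    {k : ℕ} (hk : 0 < k) {ν : Measure Torus2} [IsProbabilityMeasure ν]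
    (hν : MeasurePreserving (φ ^ k) ν ν) (hfst : MeasurePreserving Prod.fst ν volume) :
    ∀ᵐ z ∂ν, z.2 = γ z.1 := by
  refine ae_eq_of_integral_dist_nonpos measurable_snd (hγ.comp measurable_fst) ?_
  have hc : ∀ n, Continuous fun z : Torus2 => g n z.1 := fun n => by fun_prop
  have ht := integral_dist_tendsto_zero (μ := ν) (u := fun _ z => z.2) (a := fun z => z.2)
    (b := fun z => γ z.1) (fun _ => measurable_snd) (fun n => (hc n).measurable)
    (ae_of_all _ fun z => tendsto_const_nhds)
    (hfst.quasiMeasurePreserving.tendsto_ae.eventually hlim)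
  refine le_of_tendsto_of_tendsto' ht (a₂ := 0) ?_
    fun n => ((hg n).pow hk).integral_dist_le hν
  simpa using hε.const_mul (k : ℝ)

/-- There is a measurable graph which carries the unique invariant measure of all positive iterates:
the limit of the tracking graphs. -/
lemma exists_graph_measure (hβ : ∀ z, (φ z).1 = z.1 + (α : Circle1)) (hα : Irrational α)
    (h : HasDenseTrackingGraphs φ) :
    ∃ γ : Circle1 → Circle1, Measurable γ ∧ ∀ k : ℕ, 0 < k →
      IsUniqueInvariantMeasure (φ ^ k) (Measure.map (fun x => (x, γ x)) volume) := by
  obtain ⟨g, ε, γ, hγ, hg, hε, hlim⟩ := exists_tendsto_tracking_graphs hβ h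
  have hG : Measurable fun x : Circle1 => (x, γ x) := measurable_id.prodMk hγ
  refine ⟨γ, hγ, fun k hk => ⟨Measure.isProbabilityMeasure_map hG.aemeasurable, ?_, ?_⟩⟩
  · refine measurePreserving_pow ?_ k
    refine ⟨φ.continuous.measurable, ?_⟩
    have hinv := graph_limit_ae_invariant hβ hγ hg hε hlim
    rw [Measure.map_map φ.continuous.measurable hG]
    have h1 : Measure.map (φ ∘ fun x => (x, γ x)) volume =
        Measure.map ((fun x => (x, γ x)) ∘ fun x => x + (α : Circle1)) volume := by
      refine Measure.map_congr ?_
      filter_upwards [hinv] with x hx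
      exact Prod.ext (hβ _) hx
    rw [h1, ← Measure.map_map hG (measurable_add_const _),
      (measurePreserving_add_right volume (α : Circle1)).map_eq]
  · intro ν hν1 hν
    have hfst := measurePreserving_fst (pow_fst hβ k) (denseRange_nsmul_zsmul hα hk) hν
    have hae := ae_mem_graph_limit hγ hg hε hlim hk hν hfst
    rw [← hfst.map_eq, Measure.map_map hG measurable_fst]
    conv_lhs => rw [← Measure.map_id (μ := ν)]
    refine Measure.map_congr ?_
    filter_upwards [hae] with z hz
    exact Prod.ext rfl hz

lemma isMinimal_inv {X : Type*} [MetricSpace X] [CompactSpace X] {ψ : X ≃ₜ X} (h : IsMinimal ψ) :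
    IsMinimal ψ⁻¹ := by
  intro K hK hne hinv
  refine h K hK hne ?_
  conv_lhs => rw [← hinv]
  rw [← Set.image_comp]
  have : ⇑ψ ∘ ⇑ψ⁻¹ = id := funext ψ.apply_symm_apply
  rw [this, Set.image_id]

lemma isUniqueInvariantMeasure_inv {X : Type*} [MetricSpace X] [CompactSpace X]
    [MeasurableSpace X] [BorelSpace X] {ψ : X ≃ₜ X} {μ : Measure X}
    (h : IsUniqueInvariantMeasure ψ μ) : IsUniqueInvariantMeasure ψ⁻¹ μ := by
  have key : ∀ (χ : X ≃ₜ X) (ν : Measure X), MeasurePreserving χ ν ν →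
      MeasurePreserving χ.symm ν ν := fun χ ν hν =>
    MeasurePreserving.symm χ.toMeasurableEquiv hν
  exact ⟨h.1, key ψ μ h.2.1, fun ν hν1 hν => h.2.2 ν hν1 (key ψ⁻¹ ν hν)⟩

lemma isTotallyStrictlyErgodic_of_tracking (hβ : ∀ z, (φ z).1 = z.1 + (α : Circle1))
    (hα : Irrational α) (h : HasDenseTrackingGraphs φ) : IsTotallyStrictlyErgodic φ := by
  obtain ⟨γ, -, hμ⟩ := exists_graph_measure hβ hα h
  intro n hn
  have hk : 0 < n.natAbs := Int.natAbs_pos.2 hn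
  rcases Int.natAbs_eq n with h1 | h1
  · rw [h1, zpow_natCast]
    exact ⟨isMinimal_pow hβ hα h hk, _, hμ _ hk⟩
  · rw [h1, zpow_neg, zpow_natCast]
    exact ⟨isMinimal_inv (isMinimal_pow hβ hα h hk), _, isUniqueInvariantMeasure_inv (hμ _ hk)⟩

end Ergodicity

/-! ### Mean equicontinuity and the maximal equicontinuous factor -/

section MeanEquicontinuity

variable {φ : Torus2 ≃ₜ Torus2} {g : C(Circle1, Circle1)} {ε : ℝ} {β : Circle1}

/-- The vertical distance of two orbits is at most the sum of their distances to the graph of `g` and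
the oscillation of `g`. -/
lemma dist_pow_le (hβ : ∀ z, (φ z).1 = z.1 + β) {D : ℝ} {z w : Torus2}
    (hD : ∀ t : Circle1, dist (z.1 + t) (w.1 + t) + dist (g (z.1 + t)) (g (w.1 + t)) ≤ D) (i : ℕ) :
    dist ((φ ^ i) z) ((φ ^ i) w) ≤ D + (dist ((φ ^ i) z).2 (g ((φ ^ i) z).1) +
      dist ((φ ^ i) w).2 (g ((φ ^ i) w).1)) := by
  have h := hD (i • β)
  rw [← pow_fst hβ, ← pow_fst hβ] at h
  generalize (φ ^ i) z = a at *
  generalize (φ ^ i) w = b at *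
  have h1 : dist a b ≤ dist a.1 b.1 + dist a.2 b.2 :=
    max_le_add_of_nonneg dist_nonneg dist_nonneg
  have h2 := dist_triangle4 a.2 (g a.1) (g b.1) b.2
  rw [dist_comm (g b.1)] at h2
  linarith

/-- The Besicovitch distance is bounded by twice the tracking error and the oscillation of `g`. -/
lemma besicovitchDist_le (hβ : ∀ z, (φ z).1 = z.1 + β) (h : IsTrackedBy φ g ε) {D : ℝ}
    {z w : Torus2}
    (hD : ∀ t : Circle1, dist (z.1 + t) (w.1 + t) + dist (g (z.1 + t)) (g (w.1 + t)) ≤ D) :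
    besicovitchDist φ z w ≤ D + 2 * ε := by
  have hε := h.nonneg
  obtain ⟨N, hN, h⟩ := h
  have hsum : ∀ (n : ℕ) (z : Torus2),
      ∑ i ∈ Finset.range n, dist ((φ ^ i) z).2 (g ((φ ^ i) z).1) ≤ (n + N) * ε := by
    intro n z
    have h1 : n ≤ (n / N + 1) * N := by
      rw [add_mul, one_mul]
      have := Nat.div_add_mod' n N
      have := Nat.mod_lt n hN
      omega
    have h2 : (n / N + 1) * N ≤ n + N := by
      rw [add_mul, one_mul]
      exact Nat.add_le_add_right (Nat.div_mul_le_self n N) N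
    refine (Finset.sum_le_sum_of_subset_of_nonneg (Finset.range_subset_range.2 h1)
      fun _ _ _ => dist_nonneg).trans ((sum_range_mul_le h _ z).trans ?_)
    gcongr
    exact_mod_cast h2
  have hle : ∀ᶠ n : ℕ in atTop,
      (1 / (n : ℝ)) * ∑ i ∈ Finset.range n, dist ((φ ^ i) z) ((φ ^ i) w) ≤
        D + 2 * ε + 2 * N * ε * (1 / (n : ℝ)) := by
    filter_upwards [eventually_gt_atTop 0] with n hn
    have hn' : (0 : ℝ) < n := by exact_mod_cast hn
    have h1 : ∑ i ∈ Finset.range n, dist ((φ ^ i) z) ((φ ^ i) w) ≤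
        n * D + ((n + N) * ε + (n + N) * ε) := by
      refine (Finset.sum_le_sum fun i _ => dist_pow_le hβ hD i).trans ?_
      rw [Finset.sum_add_distrib, Finset.sum_add_distrib]
      simp only [Finset.sum_const, Finset.card_range, nsmul_eq_mul]
      gcongr <;> exact hsum n _
    calc _ ≤ (1 / (n : ℝ)) * (n * D + ((n + N) * ε + (n + N) * ε)) := by gcongr
      _ = _ := by field_simp; ring
  have ht : Tendsto (fun n : ℕ => D + 2 * ε + 2 * N * ε * (1 / (n : ℝ))) atTop
      (𝓝 (D + 2 * ε + 2 * N * ε * 0)) :=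
    (tendsto_one_div_atTop_nhds_zero_nat.const_mul _).const_add _
  have := limsup_le_limsup hle
    (isCoboundedUnder_le_of_le atTop (x := 0) fun n => by positivity) ht.isBoundedUnder_le
  rw [ht.limsup_eq, mul_zero, add_zero] at this
  exact this

lemma HasDenseTrackingGraphs.exists_lt (h : HasDenseTrackingGraphs φ) {r : ℝ} (hr : 0 < r) :
    ∃ (g : C(Circle1, Circle1)) (ε : ℝ), IsTrackedBy φ g ε ∧ ε ≤ r := by
  obtain ⟨g, ε, -, hg, hgr⟩ := h r hr
  exact ⟨g, ε, hg, (hgr 0).trans (mul_le_of_le_one_right hr.le measureReal_le_one)⟩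

lemma isMeanEquicontinuous_of_tracking (hβ : ∀ z, (φ z).1 = z.1 + β)
    (h : HasDenseTrackingGraphs φ) : IsMeanEquicontinuous φ := by
  intro ε hε
  obtain ⟨g, ε', hg, hε'⟩ := h.exists_lt (show 0 < ε / 8 by positivity)
  obtain ⟨δ, hδ, hgδ⟩ := Metric.uniformContinuous_iff.1
    (CompactSpace.uniformContinuous_of_continuous g.continuous) (ε / 8) (by positivity)
  refine ⟨min δ (ε / 8), by positivity, fun z w hzw => ?_⟩
  have h1 : dist z.1 w.1 < min δ (ε / 8) := lt_of_le_of_lt (le_max_left _ _) hzw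
  have := besicovitchDist_le hβ hg (D := ε / 4) (z := z) (w := w) fun t => by
    have h2 : dist (z.1 + t) (w.1 + t) < min δ (ε / 8) := by rwa [dist_add_right]
    have h3 := hgδ (h2.trans_le (min_le_left _ _))
    have h4 := h2.trans_le (min_le_right _ _)
    linarith
  linarith

/-- Two points in the same fibre come arbitrarily close under iteration. -/
lemma exists_dist_pow_lt_of_fst_eq (hβ : ∀ z, (φ z).1 = z.1 + β) (h : HasDenseTrackingGraphs φ)
    {z w : Torus2} (hzw : z.1 = w.1) {δ : ℝ} (hδ : 0 < δ) :
    ∃ i : ℕ, dist ((φ ^ i) z) ((φ ^ i) w) < δ := by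
  obtain ⟨g, ε, ⟨N, hN, hg⟩, hε⟩ := h.exists_lt (show 0 < δ / 4 by positivity)
  by_contra! hc
  have h1 : ∀ i ∈ Finset.range N, δ ≤ dist ((φ ^ i) z).2 (g ((φ ^ i) z).1) +
      dist ((φ ^ i) w).2 (g ((φ ^ i) w).1) := fun i _ =>
    (hc i).trans ((dist_pow_le hβ (D := 0) (by simp [hzw]) i).trans_eq (zero_add _))
  have h2 := Finset.sum_le_sum h1
  rw [Finset.sum_add_distrib, Finset.sum_const, Finset.card_range, nsmul_eq_mul] at h2
  have h3 := hg z
  have h4 := hg w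
  have hN' : (0 : ℝ) < N := by exact_mod_cast hN
  nlinarith

/-- Equicontinuous homeomorphisms of compact spaces are distal. The reason is that any two points
are simultaneously recurrent: their backward orbits accumulate, and the accumulation is transported
forward by equicontinuity. -/
lemma IsEquicontinuous.eq_of_proximal {Z : Type*} [MetricSpace Z] [CompactSpace Z] {ρ : Z ≃ₜ Z}
    (hρ : IsEquicontinuous ρ) {a b : Z}
    (h : ∀ δ > 0, ∃ i : ℕ, dist ((ρ ^ i) a) ((ρ ^ i) b) < δ) : a = b := by
  refine dist_le_zero.1 (le_of_forall_pos_le_add fun η hη => ?_)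
  obtain ⟨δ, hδ, hρδ⟩ := Metric.uniformEquicontinuous_iff.1 hρ (η / 3) (by positivity)
  obtain ⟨i, hi⟩ := h δ hδ
  obtain ⟨l, s, hs, hl⟩ := CompactSpace.tendsto_subseq
    fun n : ℕ => ((ρ ^ (-(n : ℤ))) a, (ρ ^ (-(n : ℤ))) b)
  obtain ⟨M, hM⟩ := Metric.cauchySeq_iff.1 hl.cauchySeq δ hδ
  have hd := hM M le_rfl (M + i) (Nat.le_add_right M i)
  have hsi : i + s M ≤ s (M + i) := by
    have := hs.add_le_nat i M
    rwa [add_comm i M] at this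
  obtain ⟨j, hj⟩ := Nat.exists_eq_add_of_le hsi
  have key : ∀ c : Z, dist ((ρ ^ (-(s M : ℤ))) c) ((ρ ^ (-(s (M + i) : ℤ))) c) < δ →
      dist ((ρ ^ j) ((ρ ^ i) c)) c < η / 3 := by
    intro c hc
    have := hρδ _ _ hc (s (M + i))
    rw [← zpow_natCast, ← Homeomorph.mul_apply, ← Homeomorph.mul_apply, ← zpow_add, ← zpow_add,
      add_neg_cancel, zpow_zero, hj] at this
    rw [← Homeomorph.mul_apply, ← pow_add, ← zpow_natCast]
    convert this using 4
    · push_cast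
      ring
    · rfl
  have h1 := key a ((le_max_left _ _).trans_lt hd)
  have h2 := key b ((le_max_right _ _).trans_lt hd)
  have h3 := hρδ _ _ hi j
  have h4 := dist_triangle4 a ((ρ ^ j) ((ρ ^ i) a)) ((ρ ^ j) ((ρ ^ i) b)) b
  have h5 := dist_comm a ((ρ ^ j) ((ρ ^ i) a))
  linarith

lemma isEquicontinuous_circleRotation (α : ℝ) : IsEquicontinuous (circleRotation α) := by
  refine Metric.uniformEquicontinuous_iff.2 fun ε hε => ⟨ε, hε, fun x y hxy n => ?_⟩
  rw [circleRotation, addRight_pow_apply, addRight_pow_apply, dist_add_right]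
  exact hxy

lemma isMaximalEquicontinuousFactor_of_tracking {α : ℝ}
    (hβ : ∀ z, (φ z).1 = z.1 + (α : Circle1)) (h : HasDenseTrackingGraphs φ) :
    IsMaximalEquicontinuousFactor φ (circleRotation α) Prod.fst := by
  refine ⟨⟨continuous_fst, Prod.fst_surjective, funext hβ⟩,
    isEquicontinuous_circleRotation α, ?_⟩
  intro Z _ _ ρ p hp hρ
  have hiter : ∀ (i : ℕ) z, p ((φ ^ i) z) = (ρ ^ i) (p z) := by
    intro i z
    induction i generalizing z with
    | zero => rfl
    | succ i ih =>
      rw [pow_succ, pow_succ, Homeomorph.mul_apply, Homeomorph.mul_apply, ih]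
      exact congrArg _ (congrFun hp.semiconj z)
  have hfib : ∀ z w : Torus2, z.1 = w.1 → p z = p w := by
    intro z w hzw
    refine hρ.eq_of_proximal fun δ hδ => ?_
    obtain ⟨η, hη, hpη⟩ := Metric.uniformContinuous_iff.1
      (CompactSpace.uniformContinuous_of_continuous hp.continuous) δ hδ
    obtain ⟨i, hi⟩ := exists_dist_pow_lt_of_fst_eq hβ h hzw hη
    exact ⟨i, by simpa only [hiter] using hpη hi⟩
  have hq : p = (fun x => p (x, 0)) ∘ Prod.fst := funext fun z => hfib _ _ rfl
  refine ⟨fun x => p (x, 0), ⟨⟨?_, ?_, ?_⟩, hq⟩, ?_⟩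
  · exact hp.continuous.comp (by fun_prop)
  · intro y
    obtain ⟨z, rfl⟩ := hp.surjective y
    exact ⟨z.1, hfib _ _ rfl⟩
  · funext x
    have := congrFun hp.semiconj (x, 0)
    simp only [Function.comp_apply] at this ⊢
    rw [← this]
    exact hfib _ _ (hβ (x, 0)).symm
  · rintro q ⟨-, hpq⟩
    funext x
    exact (congrFun hpq (x, 0)).symm

end MeanEquicontinuity

/-! ### Möbius maps of the circle -/

/-- The lift to `ℝ` of the hyperbolic Möbius map `z ↦ (z + c) / (1 + c z)` of the unit circle, in
the coordinate `z = exp (2 π i u)`. For `0 < c < 1` it has the attracting fixed point `0` and the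
repelling fixed point `1 / 2`. -/
noncomputable def mob (c u : ℝ) : ℝ :=
  u - Real.arctan (c * Real.sin (2 * Real.pi * u) / (1 + c * Real.cos (2 * Real.pi * u))) / Real.pi

lemma one_add_mul_cos_pos {c : ℝ} (hc : |c| < 1) (θ : ℝ) : 0 < 1 + c * Real.cos θ := by
  have h1 : |c * Real.cos θ| ≤ |c| := by
    rw [abs_mul]
    exact mul_le_of_le_one_right (abs_nonneg c) (Real.abs_cos_le_one θ)
  have := neg_abs_le (c * Real.cos θ)
  linarith

lemma contDiff_mob {c : ℝ} (hc : |c| < 1) : ContDiff ℝ ∞ (mob c) := by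
  unfold mob
  refine contDiff_id.sub (ContDiff.div_const (Real.contDiff_arctan.comp (ContDiff.div ?_ ?_ ?_)) _)
  · fun_prop
  · fun_prop
  · exact fun u => (one_add_mul_cos_pos hc _).ne'

lemma mob_add_int (c u : ℝ) (k : ℤ) : mob c (u + k) = mob c u + k := by
  have h : 2 * Real.pi * (u + k) = 2 * Real.pi * u + k * (2 * Real.pi) := by ring
  rw [mob, mob, h, Real.sin_add_int_mul_two_pi, Real.cos_add_int_mul_two_pi]
  ring

lemma mob_neg_mob {c : ℝ} (hc : |c| < 1) (u : ℝ) : mob (-c) (mob c u) = u := by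
  set θ := 2 * Real.pi * u with hθ
  have hpos := one_add_mul_cos_pos hc θ
  set τ := Real.arctan (c * Real.sin θ / (1 + c * Real.cos θ)) with hτ
  have hm : mob c u = u - τ / Real.pi := rfl
  have hcτ : 0 < Real.cos τ := Real.cos_arctan_pos _
  have ht : Real.sin τ * (1 + c * Real.cos θ) = c * Real.sin θ * Real.cos τ := by
    have h1 : Real.tan τ = c * Real.sin θ / (1 + c * Real.cos θ) := Real.tan_arctan _
    rw [Real.tan_eq_sin_div_cos, div_eq_div_iff hcτ.ne' hpos.ne'] at h1
    exact h1
  have h2 : 2 * Real.pi * (u - τ / Real.pi) = θ - τ - τ := by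
    rw [hθ]
    field_simp
    ring
  have hpos' := one_add_mul_cos_pos (c := -c) (by rwa [abs_neg]) (θ - τ - τ)
  have hsin : Real.sin τ = c * Real.sin (θ - τ) := by
    rw [Real.sin_sub]
    linarith
  -- Both sides are `-tan τ`, so the two correction terms cancel.
  have key : -c * Real.sin (θ - τ - τ) / (1 + -c * Real.cos (θ - τ - τ)) =
      -(c * Real.sin θ / (1 + c * Real.cos θ)) := by
    rw [← neg_div, div_eq_div_iff hpos'.ne' hpos.ne']
    have e1 : Real.sin θ = Real.sin (θ - τ) * Real.cos τ + Real.cos (θ - τ) * Real.sin τ := by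
      rw [← Real.sin_add, sub_add_cancel]
    have e2 : Real.cos θ = Real.cos (θ - τ) * Real.cos τ - Real.sin (θ - τ) * Real.sin τ := by
      rw [← Real.cos_add, sub_add_cancel]
    rw [Real.sin_sub (θ - τ) τ, Real.cos_sub (θ - τ) τ, e1, e2]
    have hsq : (c * Real.sin (θ - τ)) ^ 2 + Real.cos τ ^ 2 = 1 := by
      rw [← hsin, Real.sin_sq_add_cos_sq]
    rw [hsin]
    clear_value τ
    generalize Real.sin (θ - τ) = s at *
    generalize Real.cos (θ - τ) = k at *
    generalize Real.cos τ = b at *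
    linear_combination (-2 * c ^ 2 * s * k) * hsq
  rw [hm, mob, h2, key, Real.arctan_neg]
  ring

lemma mob_mob_neg {c : ℝ} (hc : |c| < 1) (u : ℝ) : mob c (mob (-c) u) = u := by
  simpa using mob_neg_mob (c := -c) (by rwa [abs_neg]) u

/-- At `c = 1` the Möbius map degenerates: everything but the repelling point goes to `0`. -/
lemma mob_one {u : ℝ} (h1 : -(1 / 2) < u) (h2 : u < 1 / 2) : mob 1 u = 0 := by
  have hpi := Real.pi_pos
  have hc : 0 < Real.cos (Real.pi * u) :=
    Real.cos_pos_of_mem_Ioo ⟨by nlinarith, by nlinarith⟩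
  have h3 : 2 * Real.pi * u = 2 * (Real.pi * u) := by ring
  have h4 : 1 * Real.sin (2 * Real.pi * u) / (1 + 1 * Real.cos (2 * Real.pi * u)) =
      Real.tan (Real.pi * u) := by
    rw [h3, Real.sin_two_mul, Real.cos_two_mul, Real.tan_eq_sin_div_cos]
    field_simp
    ring
  rw [mob, h4, Real.arctan_tan (by nlinarith) (by nlinarith)]
  field_simp
  ring

lemma continuousAt_mob_one {u : ℝ} (h1 : -(1 / 2) < u) (h2 : u < 1 / 2) :
    ContinuousAt (fun c => mob c u) 1 := by
  have hpi := Real.pi_pos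
  have hc : 0 < Real.cos (Real.pi * u) :=
    Real.cos_pos_of_mem_Ioo ⟨by nlinarith, by nlinarith⟩
  have h3 : 2 * Real.pi * u = 2 * (Real.pi * u) := by ring
  have : 1 + 1 * Real.cos (2 * Real.pi * u) ≠ 0 := by
    rw [h3, Real.cos_two_mul]
    nlinarith
  unfold mob
  fun_prop (disch := assumption)

lemma continuous_coe_circle : Continuous fun t : ℝ => (t : Circle1) :=
  AddCircle.continuous_mk' 1

/-- The contraction is strong on average. -/
lemma exists_integral_norm_mob_lt {ε : ℝ} (hε : 0 < ε) :
    ∃ c : ℝ, |c| < 1 ∧ ∫ u in (0 : ℝ)..1, ‖((mob c u : ℝ) : Circle1)‖ < ε := by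
  have hper : ∀ c : ℝ, Function.Periodic (fun u => ‖((mob c u : ℝ) : Circle1)‖) 1 := by
    intro c u
    have := mob_add_int c u 1
    simp only [Int.cast_one] at this
    simp [this]
  set c : ℕ → ℝ := fun n => 1 - 1 / ((n : ℝ) + 2) with hc
  have hc1 : ∀ n, |c n| < 1 := by
    intro n
    have h1 : 0 < 1 / ((n : ℝ) + 2) := by positivity
    have h2 : 1 / ((n : ℝ) + 2) < 1 := by
      rw [div_lt_one (by positivity)]
      linarith [(Nat.cast_nonneg n : (0 : ℝ) ≤ n)]
    rw [abs_lt, hc]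
    constructor <;> simp only <;> linarith
  have hct : Tendsto c atTop (𝓝 1) := by
    have := (tendsto_const_nhds (x := (1 : ℝ)) (f := atTop (α := ℕ))).sub
      ((tendsto_const_nhds (x := (1 : ℝ))).div_atTop
        (tendsto_natCast_atTop_atTop.atTop_add (tendsto_const_nhds (x := (2 : ℝ)))))
    simpa [hc] using this
  have hlim : Tendsto (fun n => ∫ u in (-(1 / 2) : ℝ)..(1 / 2), ‖((mob (c n) u : ℝ) : Circle1)‖)
      atTop (𝓝 (∫ u in (-(1 / 2) : ℝ)..(1 / 2), (0 : ℝ))) := by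
    refine intervalIntegral.tendsto_integral_filter_of_dominated_convergence (fun _ => 1)
      (Eventually.of_forall fun n => ?_) (Eventually.of_forall fun n => ae_of_all _ fun u _ => ?_)
      intervalIntegrable_const ?_
    · exact (continuous_coe_circle.comp
        (contDiff_mob (hc1 n)).continuous).norm.aestronglyMeasurable
    · rw [norm_norm, ← dist_zero_right]
      exact circle_dist_le_one _ _
    · have : ∀ᵐ u : ℝ, u ≠ 1 / 2 := by simp [ae_iff]
      filter_upwards [this] with u hu hu'
      rw [Set.uIoc_of_le (by norm_num)] at hu'
      have h2 : u < 1 / 2 := lt_of_le_of_ne hu'.2 hu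
      have h3 := (continuousAt_mob_one hu'.1 h2).tendsto.comp hct
      rw [mob_one hu'.1 h2] at h3
      have h4 := (continuous_coe_circle.norm.tendsto 0).comp h3
      simpa [Function.comp_def] using h4
  rw [intervalIntegral.integral_zero] at hlim
  obtain ⟨n, hn⟩ := (hlim.eventually (gt_mem_nhds hε)).exists
  refine ⟨c n, hc1 n, ?_⟩
  have := (hper (c n)).intervalIntegral_add_eq 0 (-(1 / 2))
  norm_num at this hn
  rwa [this]

lemma uniformContinuous_of_periodic {f : ℝ → ℝ} (hf : Continuous f)
    (hp : Function.Periodic f 1) : UniformContinuous f := by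
  have h1 : Continuous (hp.lift : Circle1 → ℝ) := continuous_coinduced_dom.2 hf
  have h2 : UniformContinuous (QuotientAddGroup.mk' (AddSubgroup.zmultiples (1 : ℝ))) :=
    uniformContinuous_of_continuousAt_zero _ (AddCircle.continuous_mk' 1).continuousAt
  exact (CompactSpace.uniformContinuous_of_continuous h1).comp h2

/-- Riemann sums of a continuous periodic function converge uniformly in the starting point. -/
lemma eventually_sum_le_of_periodic {f : ℝ → ℝ} (hf : Continuous f) (hp : Function.Periodic f 1)
    {C : ℝ} (hC : ∫ u in (0 : ℝ)..1, f u < C) :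
    ∀ᶠ m : ℕ in atTop, ∀ u : ℝ, ∑ i ∈ Finset.range m, f (u + i / m) ≤ m * C := by
  set I := ∫ u in (0 : ℝ)..1, f u with hI
  have hu : UniformContinuous f := uniformContinuous_of_periodic hf hp
  obtain ⟨δ, hδ, hfδ⟩ := Metric.uniformContinuous_iff.1 hu (C - I) (by linarith)
  filter_upwards [eventually_gt_atTop 0,
    (tendsto_one_div_atTop_nhds_zero_nat (𝕜 := ℝ)).eventually (gt_mem_nhds hδ)] with m hm hmδ u
  have hm' : (0 : ℝ) < m := by exact_mod_cast hm
  have h1 : ∫ t in (0 : ℝ)..1, f (u + t) = I := by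
    rw [intervalIntegral.integral_comp_add_left (fun x => f x), add_zero,
      hp.intervalIntegral_add_eq u 0, zero_add]
  have h2 : ∫ t in (0 : ℝ)..1, f (u + t) =
      ∑ i ∈ Finset.range m, ∫ t in ((i : ℕ) / m : ℝ)..((i + 1 : ℕ) / m : ℝ), f (u + t) := by
    rw [intervalIntegral.sum_integral_adjacent_intervals (a := fun i : ℕ => (i / m : ℝ))
      fun i _ => (by fun_prop : Continuous fun t => f (u + t)).intervalIntegrable _ _]
    simp [hm'.ne']
  have h3 : ∀ i ∈ Finset.range m, (f (u + i / m) - (C - I)) / m ≤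
      ∫ t in ((i : ℕ) / m : ℝ)..((i + 1 : ℕ) / m : ℝ), f (u + t) := by
    intro i _
    have hle : (i / m : ℝ) ≤ ((i + 1 : ℕ) / m : ℝ) := by gcongr; simp
    have h4 : ∫ _ in ((i : ℕ) / m : ℝ)..((i + 1 : ℕ) / m : ℝ), (f (u + i / m) - (C - I)) =
        (f (u + i / m) - (C - I)) / m := by
      rw [intervalIntegral.integral_const, smul_eq_mul]
      push_cast
      field_simp
      ring
    rw [← h4]
    refine intervalIntegral.integral_mono_on hle intervalIntegrable_const
      ((by fun_prop : Continuous fun t => f (u + t)).intervalIntegrable _ _) fun t ht => ?_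
    have h5 : dist (u + i / m) (u + t) < δ := by
      rw [dist_add_left, Real.dist_eq, abs_sub_comm, abs_of_nonneg (by linarith [ht.1])]
      have := ht.2
      push_cast at this
      rw [add_div] at this
      linarith
    have h6 := hfδ h5
    rw [Real.dist_eq] at h6
    linarith [le_abs_self (f (u + i / m) - f (u + t))]
  have h7 := Finset.sum_le_sum h3
  rw [← h2, h1, ← Finset.sum_div, Finset.sum_sub_distrib, Finset.sum_const, Finset.card_range,
    nsmul_eq_mul, div_le_iff₀ hm'] at h7
  linarith

/-! ### Fibred diffeomorphisms of the torus -/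

/-- `f : ℝ² → ℝ` is the second coordinate of a lift of a fibred map of the torus which has degree `1`
on the fibres. -/
def IsFibreLift (f : ℝ × ℝ → ℝ) : Prop :=
  ∀ (x y : ℝ) (m n : ℤ), f (x + m, y + n) = f (x, y) + n

/-- A fibred diffeomorphism `(x, y) ↦ (x, H (x, y))` of the torus which is isotopic to the
identity, given by a lift `H` of its second coordinate, and a lift `K` of that of the inverse. -/
structure FibreDiffeo where
  H : ℝ × ℝ → ℝ
  K : ℝ × ℝ → ℝ
  contDiff_H : ContDiff ℝ ∞ H
  contDiff_K : ContDiff ℝ ∞ K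
  isFibreLift_H : IsFibreLift H
  isFibreLift_K : IsFibreLift K
  K_H : ∀ x y, K (x, H (x, y)) = y
  H_K : ∀ x y, H (x, K (x, y)) = y

namespace FibreDiffeo

/-- The identity. -/
def refl : FibreDiffeo where
  H := Prod.snd
  K := Prod.snd
  contDiff_H := contDiff_snd
  contDiff_K := contDiff_snd
  isFibreLift_H := fun _ _ _ _ => rfl
  isFibreLift_K := fun _ _ _ _ => rfl
  K_H := fun _ _ => rfl
  H_K := fun _ _ => rfl

/-- The composition `D ∘ E`. -/
def comp (D E : FibreDiffeo) : FibreDiffeo where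
  H := fun v => D.H (v.1, E.H v)
  K := fun v => E.K (v.1, D.K v)
  contDiff_H := D.contDiff_H.comp (contDiff_fst.prodMk E.contDiff_H)
  contDiff_K := E.contDiff_K.comp (contDiff_fst.prodMk D.contDiff_K)
  isFibreLift_H := fun x y m n => by
    simp only
    rw [E.isFibreLift_H, D.isFibreLift_H]
  isFibreLift_K := fun x y m n => by
    simp only
    rw [D.isFibreLift_K, E.isFibreLift_K]
  K_H := fun x y => by
    simp only
    rw [D.K_H, E.K_H]
  H_K := fun x y => by
    simp only
    rw [E.H_K, D.H_K]

lemma isFibreLift_twist (Q : ℕ) (c : ℝ) :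
    IsFibreLift fun v => Q * v.1 + mob c (v.2 - Q * v.1) := by
  intro x y m n
  have : y + n - Q * (x + m) = y - Q * x + ((n - Q * m : ℤ) : ℝ) := by push_cast; ring
  simp only
  rw [this, mob_add_int]
  push_cast
  ring

/-- The twisted Möbius map: for `c` close to `1`, on the fibre over `x` it contracts the complement of
a neighbourhood of `Q x + 1 / 2` into a neighbourhood of `Q x`. -/
noncomputable def twist (Q : ℕ) (c : ℝ) (hc : |c| < 1) : FibreDiffeo where
  H := fun v => Q * v.1 + mob c (v.2 - Q * v.1)
  K := fun v => Q * v.1 + mob (-c) (v.2 - Q * v.1)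
  contDiff_H := by
    have := contDiff_mob hc
    fun_prop
  contDiff_K := by
    have := contDiff_mob (c := -c) (by rwa [abs_neg])
    fun_prop
  isFibreLift_H := isFibreLift_twist Q c
  isFibreLift_K := isFibreLift_twist Q (-c)
  K_H := fun x y => by
    simp only [add_sub_cancel_left]
    rw [mob_neg_mob hc]
    ring
  H_K := fun x y => by
    simp only [add_sub_cancel_left]
    rw [mob_mob_neg hc]
    ring

lemma twist_H_add {Q : ℕ} {c : ℝ} (hc : |c| < 1) {β : ℝ} {l : ℤ} (hl : Q * β = l) (x y : ℝ) :
    (twist Q c hc).H (x + β, y) = (twist Q c hc).H (x, y) := by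
  have : y - Q * (x + β) = y - Q * x + ((-l : ℤ) : ℝ) := by
    push_cast
    rw [← hl]
    ring
  simp only [twist]
  rw [this, mob_add_int, mul_add, hl]
  push_cast
  ring

/-- The lift of the second coordinate of the conjugate `D ∘ R_β ∘ D⁻¹` of the horizontal
translation by `β`. -/
def conj (D : FibreDiffeo) (β : ℝ) (v : ℝ × ℝ) : ℝ := D.H (v.1 + β, D.K v)

variable (D : FibreDiffeo)

lemma isFibreLift_conj (β : ℝ) : IsFibreLift (D.conj β) := by
  intro x y m n
  simp only [conj]
  rw [D.isFibreLift_K, add_right_comm, D.isFibreLift_H]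

lemma contDiff_conj_uncurry : ContDiff ℝ ∞ fun p : ℝ × (ℝ × ℝ) => D.conj p.1 p.2 := by
  have := D.contDiff_H
  have := D.contDiff_K
  unfold conj
  fun_prop

lemma contDiff_conj (β : ℝ) : ContDiff ℝ ∞ (D.conj β) :=
  D.contDiff_conj_uncurry.comp (contDiff_const.prodMk contDiff_id)

lemma conj_conj (β β' x y : ℝ) : D.conj β' (x + β, D.conj β (x, y)) = D.conj (β + β') (x, y) := by
  simp only [conj]
  rw [D.K_H, add_assoc]

lemma conj_H (β x w : ℝ) : D.conj β (x, D.H (x, w)) = D.H (x + β, w) := by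
  simp only [conj]
  rw [D.K_H]

lemma conj_zero (x y : ℝ) : D.conj 0 (x, y) = y := by
  simp only [conj, add_zero]
  rw [D.H_K]

/-- Twists with frequency `Q` commute with translations by multiples of `1 / Q`. -/
lemma conj_comp_twist {Q : ℕ} {c : ℝ} (hc : |c| < 1) {β : ℝ} {l : ℤ} (hl : Q * β = l) :
    (D.comp (twist Q c hc)).conj β = D.conj β := by
  funext ⟨x, y⟩
  simp only [conj, comp]
  rw [twist_H_add hc hl, H_K]

end FibreDiffeo

/-! ### Uniform bounds by periodicity -/

lemma exists_mem_square_eq_of_periodic {E : Type*} {f : ℝ × ℝ → E}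
    (hp : ∀ (x y : ℝ) (m n : ℤ), f (x + m, y + n) = f (x, y)) (v : ℝ × ℝ) :
    ∃ w ∈ Set.Icc (0 : ℝ × ℝ) 1, f v = f w := by
  refine ⟨(Int.fract v.1, Int.fract v.2), ⟨⟨Int.fract_nonneg _, Int.fract_nonneg _⟩,
    (Int.fract_lt_one _).le, (Int.fract_lt_one _).le⟩, ?_⟩
  rw [← hp (Int.fract v.1) (Int.fract v.2) ⌊v.1⌋ ⌊v.2⌋, Int.fract_add_floor, Int.fract_add_floor]

lemma IsFibreLift.apply_add {f : ℝ × ℝ → ℝ} (hf : IsFibreLift f) (m n : ℤ) (v : ℝ × ℝ) :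
    f (v + ((m : ℝ), (n : ℝ))) = f v + n := hf v.1 v.2 m n

lemma IsFibreLift.exists_lipschitz {f : ℝ × ℝ → ℝ} (hf : IsFibreLift f) (hs : ContDiff ℝ ∞ f) :
    ∃ L : ℝ, 0 < L ∧ ∀ v w, |f v - f w| ≤ L * dist v w := by
  have hper : ∀ (x y : ℝ) (m n : ℤ), fderiv ℝ f (x + m, y + n) = fderiv ℝ f (x, y) := by
    intro x y m n
    have h1 : (fun v => f (v + ((m : ℝ), (n : ℝ)))) = fun v => f v + n :=
      funext (hf.apply_add m n)
    have h2 := fderiv_comp_add_right (𝕜 := ℝ) (f := f) (x := (x, y)) ((m : ℝ), (n : ℝ))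
    rw [h1, fderiv_add_const] at h2
    exact h2.symm
  have hc : Continuous (fderiv ℝ f) := hs.continuous_fderiv (by simp)
  obtain ⟨C, hC⟩ := (isCompact_Icc (a := (0 : ℝ × ℝ)) (b := 1)).exists_bound_of_continuousOn
    hc.continuousOn
  have hC' : ∀ v, ‖fderiv ℝ f v‖ ≤ max C 1 := by
    intro v
    obtain ⟨w, hw, hvw⟩ := exists_mem_square_eq_of_periodic hper v
    rw [hvw]
    exact (hC w hw).trans (le_max_left _ _)
  refine ⟨max C 1, by positivity, fun v w => ?_⟩
  have := convex_univ.norm_image_sub_le_of_norm_fderiv_le (𝕜 := ℝ) (f := f) (x := w) (y := v)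
    (fun x _ => (hs.differentiable (by simp)).differentiableAt) (fun x _ => hC' x) trivial trivial
  rwa [dist_eq_norm]

/-- In a smooth family of lifts, the derivatives along the torus depend continuously on the
parameter, uniformly over the plane. -/
lemma eventually_norm_iteratedFDeriv_sub_le {G : ℝ → ℝ × ℝ → ℝ}
    (hG : ContDiff ℝ ∞ fun p : ℝ × (ℝ × ℝ) => G p.1 p.2) (hl : ∀ β, IsFibreLift (G β))
    (α : ℝ) (j : ℕ) {ε : ℝ} (hε : 0 < ε) :
    ∀ᶠ β in 𝓝 α, ∀ v, ‖iteratedFDeriv ℝ j (fun v => G β v - G α v) v‖ ≤ ε := by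
  have hper : ∀ (β x y : ℝ) (m n : ℤ), iteratedFDeriv ℝ j (fun v => G β v - G α v) (x + m, y + n) =
      iteratedFDeriv ℝ j (fun v => G β v - G α v) (x, y) := by
    intro β x y m n
    have h1 : (fun v => (fun v => G β v - G α v) (v + ((m : ℝ), (n : ℝ)))) =
        fun v => G β v - G α v := by
      funext v
      simp only [(hl _).apply_add]
      ring
    have h2 := iteratedFDeriv_comp_add_right (𝕜 := ℝ) (f := fun v => G β v - G α v) j
      ((m : ℝ), (n : ℝ)) (x, y)
    rw [h1] at h2
    exact h2.symm
  set F : ℝ × (ℝ × ℝ) → ℝ := fun p => G p.1 p.2 - G α p.2 with hF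
  have hFs : ContDiff ℝ ∞ F := by
    refine hG.sub (hG.comp (g := fun p : ℝ × (ℝ × ℝ) => G p.1 p.2)
      (f := fun p : ℝ × (ℝ × ℝ) => (α, p.2)) ?_)
    fun_prop
  -- The partial derivatives are restrictions of the full ones, hence jointly continuous.
  have hpart : ∀ (β : ℝ) (v : ℝ × ℝ), iteratedFDeriv ℝ j (fun v => G β v - G α v) v =
      (iteratedFDeriv ℝ j F (β, v)).compContinuousLinearMap
        fun _ => ContinuousLinearMap.inr ℝ ℝ (ℝ × ℝ) := by
    intro β v
    have h1 : (fun v => G β v - G α v) =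
        (fun p => F (p + (β, 0))) ∘ ContinuousLinearMap.inr ℝ ℝ (ℝ × ℝ) := by
      funext w
      simp [hF]
    have h2 : ContDiff ℝ ∞ fun p => F (p + (β, 0)) := hFs.comp (by fun_prop)
    rw [h1, ContinuousLinearMap.iteratedFDeriv_comp_right _ h2 v (by exact_mod_cast le_top),
      iteratedFDeriv_comp_add_right]
    simp
  have hcont : Continuous fun p : ℝ × (ℝ × ℝ) =>
      ‖iteratedFDeriv ℝ j (fun v => G p.1 v - G α v) p.2‖ := by
    simp only [hpart]
    have h1 : Continuous (iteratedFDeriv ℝ j F) :=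
      hFs.continuous_iteratedFDeriv (by exact_mod_cast le_top)
    exact ((ContinuousMultilinearMap.compContinuousLinearMapL (𝕜 := ℝ) (F := ℝ)
      fun _ : Fin j => ContinuousLinearMap.inr ℝ ℝ (ℝ × ℝ)).continuous.comp h1).norm
  have hev : ∀ᶠ β in 𝓝 α, ∀ v ∈ Set.Icc (0 : ℝ × ℝ) 1,
      ‖iteratedFDeriv ℝ j (fun v => G β v - G α v) v‖ < ε := by
    refine isCompact_Icc.eventually_forall_of_forall_eventually fun v _ => ?_
    refine hcont.continuousAt.eventually (gt_mem_nhds ?_)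
    simp only [sub_self]
    rw [iteratedFDeriv_fun_zero]
    simpa using hε
  filter_upwards [hev] with β hβ v
  obtain ⟨w, hw, hvw⟩ := exists_mem_square_eq_of_periodic (hper β) v
  rw [hvw]
  exact (hβ w hw).le

/-! ### Maps of the torus given by lifts -/

lemma torusProj_surjective : Function.Surjective torusProj := by
  rintro ⟨x, y⟩
  obtain ⟨a, rfl⟩ := QuotientAddGroup.mk_surjective x
  obtain ⟨b, rfl⟩ := QuotientAddGroup.mk_surjective y
  exact ⟨(a, b), rfl⟩

lemma isOpenQuotientMap_torusProj : IsOpenQuotientMap torusProj :=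
  QuotientAddGroup.isOpenQuotientMap_mk.prodMap QuotientAddGroup.isOpenQuotientMap_mk

lemma coe_eq_coe_iff {a b : ℝ} : (a : Circle1) = b ↔ ∃ n : ℤ, a = b + n := by
  rw [QuotientAddGroup.eq_iff_sub_mem, AddSubgroup.mem_zmultiples_iff]
  simp only [zsmul_eq_mul, mul_one]
  constructor <;> rintro ⟨n, hn⟩ <;> exact ⟨n, by linarith⟩

/-- The fibred map of the torus over the rotation by `β` with the lift `f` of its second
coordinate. -/
noncomputable def skewFun (β : ℝ) (f : ℝ × ℝ → ℝ) (z : Torus2) : Torus2 :=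
  torusProj ((Function.surjInv torusProj_surjective z).1 + β,
    f (Function.surjInv torusProj_surjective z))

lemma skewFun_torusProj {f : ℝ × ℝ → ℝ} (hf : IsFibreLift f) (β : ℝ) (v : ℝ × ℝ) :
    skewFun β f (torusProj v) = torusProj (v.1 + β, f v) := by
  obtain ⟨h1, h2⟩ := Prod.ext_iff.1 (Function.surjInv_eq torusProj_surjective (torusProj v))
  obtain ⟨m, hm⟩ := coe_eq_coe_iff.1 h1
  obtain ⟨n, hn⟩ := coe_eq_coe_iff.1 h2
  have h3 : Function.surjInv torusProj_surjective (torusProj v) = (v.1 + m, v.2 + n) :=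
    Prod.ext hm hn
  rw [skewFun, h3, hf]
  refine Prod.ext ?_ ?_
  · exact coe_eq_coe_iff.2 ⟨m, by ring⟩
  · exact coe_eq_coe_iff.2 ⟨n, rfl⟩

lemma continuous_torusProj : Continuous torusProj := isOpenQuotientMap_torusProj.continuous

lemma continuous_skewFun {f : ℝ × ℝ → ℝ} (hf : IsFibreLift f) (hc : Continuous f) (β : ℝ) :
    Continuous (skewFun β f) := by
  rw [isOpenQuotientMap_torusProj.isQuotientMap.continuous_iff]
  have : skewFun β f ∘ torusProj = torusProj ∘ fun v => (v.1 + β, f v) :=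
    funext (skewFun_torusProj hf β)
  rw [this]
  exact continuous_torusProj.comp (by fun_prop)

lemma dist_coe_le (a b : ℝ) : dist (a : Circle1) b ≤ |a - b| := by
  rw [dist_eq_norm, ← AddCircle.coe_sub, UnitAddCircle.norm_eq]
  simpa using round_le (a - b) 0

lemma dist_torusProj_le {v w : ℝ × ℝ} {C : ℝ} (h1 : |v.1 - w.1| ≤ C) (h2 : |v.2 - w.2| ≤ C) :
    dist (torusProj v) (torusProj w) ≤ C :=
  max_le ((dist_coe_le _ _).trans h1) ((dist_coe_le _ _).trans h2)

lemma dist_skewFun_le {f f' : ℝ × ℝ → ℝ} (hf : IsFibreLift f) (hf' : IsFibreLift f') {β β' C : ℝ}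
    (h1 : |β - β'| ≤ C) (h2 : ∀ v, |f v - f' v| ≤ C) (z : Torus2) :
    dist (skewFun β f z) (skewFun β' f' z) ≤ C := by
  obtain ⟨v, rfl⟩ := torusProj_surjective z
  rw [skewFun_torusProj hf, skewFun_torusProj hf']
  exact dist_torusProj_le (by simpa using h1) (h2 v)

namespace FibreDiffeo

variable (D : FibreDiffeo)

/-- The conjugate `D ∘ R_β ∘ D⁻¹` of the horizontal translation by `β`, as a map of the torus. -/
noncomputable def skewMap (β : ℝ) : C(Torus2, Torus2) where
  toFun := skewFun β (D.conj β)
  continuous_toFun := continuous_skewFun (D.isFibreLift_conj β) (D.contDiff_conj β).continuous β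

lemma skewMap_apply (β : ℝ) (v : ℝ × ℝ) :
    D.skewMap β (torusProj v) = torusProj (v.1 + β, D.conj β v) :=
  skewFun_torusProj (D.isFibreLift_conj β) β v

lemma iterate_skewMap (β x w : ℝ) (i : ℕ) :
    (D.skewMap β)^[i] (torusProj (x, D.H (x, w))) =
      torusProj (x + i * β, D.H (x + i * β, w)) := by
  induction i with
  | zero => simp
  | succ i ih =>
    rw [Function.iterate_succ_apply', ih, skewMap_apply]
    simp only [conj_H]
    push_cast
    simp only [add_mul, one_mul, add_assoc]

/-- The image under `D` of the closed curve `{(x, Q x)}`, as a graph over the circle. -/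
noncomputable def graph (Q : ℕ) : C(Circle1, Circle1) where
  toFun := Function.Periodic.lift (f := fun x : ℝ => ((D.H (x, Q * x) : ℝ) : Circle1)) (c := 1) (by
    intro x
    have := D.isFibreLift_H x (Q * x) 1 Q
    push_cast at this
    simp only
    rw [show (Q : ℝ) * (x + 1) = Q * x + Q by ring, this]
    exact coe_eq_coe_iff.2 ⟨Q, rfl⟩)
  continuous_toFun := continuous_coinduced_dom.2 (by
    have := D.contDiff_H.continuous
    exact continuous_coe_circle.comp (by fun_prop))

lemma graph_coe (Q : ℕ) (x : ℝ) : D.graph Q (x : Circle1) = ((D.H (x, Q * x) : ℝ) : Circle1) :=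
  rfl

/-- For frequencies `Q` divisible by `q` and large enough, the graph is dense up to `r`. -/
lemma exists_graph_dense {q : ℕ} (hq : 0 < q) {r : ℝ} (hr : 0 < r) :
    ∃ Q : ℕ, 0 < Q ∧ q ∣ Q ∧ ∀ z : Torus2, ∃ x : Circle1, dist (x, D.graph Q x) z < r := by
  obtain ⟨L, hL, hDL⟩ := D.isFibreLift_H.exists_lipschitz D.contDiff_H
  obtain ⟨m, hm⟩ := exists_nat_gt ((1 + L) / r)
  have hm0 : (0 : ℝ) < m := lt_trans (by positivity) hm
  have hm1 : 0 < m := by exact_mod_cast hm0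
  refine ⟨q * m, Nat.mul_pos hq hm1, dvd_mul_right q m, fun z => ?_⟩
  set Q := q * m with hQ
  have hQm : (m : ℝ) ≤ Q := by exact_mod_cast Nat.le_mul_of_pos_left m hq
  have hQ0 : (0 : ℝ) < Q := hm0.trans_le hQm
  obtain ⟨⟨a, b⟩, rfl⟩ := torusProj_surjective z
  set w := D.K (a, b) with hw
  have hb : D.H (a, w) = b := D.H_K a b
  -- The curve passes at the height of `w` in the fibre over `x`, at distance at most `1 / Q` of `a`.
  set k := ⌊Q * a - w⌋ with hk
  set x := (w + k) / Q with hx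
  have hQx : Q * x = w + k := by rw [hx]; field_simp
  have hxa : |x - a| ≤ 1 / Q := by
    have h1 := Int.floor_le (Q * a - w)
    have h2 := Int.lt_floor_add_one (Q * a - w)
    rw [← hk] at h1 h2
    have h3 : |(Q : ℝ) * (x - a)| ≤ 1 := by
      rw [mul_sub, hQx, abs_le]
      constructor <;> linarith
    rw [abs_mul, abs_of_pos hQ0] at h3
    rw [le_div_iff₀ hQ0]
    linarith
  have hr' : (1 + L) / Q < r := by
    rw [div_lt_iff₀ hQ0]
    rw [div_lt_iff₀ hr] at hm
    nlinarith
  have hH : D.H (x, Q * x) = D.H (x, w) + k := by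
    rw [hQx]
    simpa using D.isFibreLift_H x w 0 k
  refine ⟨(x : Circle1), lt_of_le_of_lt ?_ hr'⟩
  rw [graph_coe, hH]
  have e : (((D.H (x, w) + k : ℝ)) : Circle1) = ((D.H (x, w) : ℝ) : Circle1) :=
    coe_eq_coe_iff.2 ⟨k, rfl⟩
  rw [e]
  refine dist_torusProj_le (v := (x, D.H (x, w))) (w := (a, b)) ?_ ?_
  · refine hxa.trans ?_
    gcongr
    linarith
  · have h1 := hDL (x, w) (a, w)
    rw [Prod.dist_eq, dist_self, max_eq_left dist_nonneg, Real.dist_eq, hb] at h1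
    refine h1.trans ?_
    calc L * |x - a| ≤ L * (1 / Q) := by gcongr
      _ ≤ _ := by rw [mul_one_div]; gcongr; linarith

lemma dist_H_le {L : ℝ} (hL : ∀ v w, |D.H v - D.H w| ≤ L * dist v w) (x a b : ℝ) :
    dist ((D.H (x, a) : ℝ) : Circle1) ((D.H (x, b) : ℝ) : Circle1) ≤
      L * ‖((a - b : ℝ) : Circle1)‖ := by
  set k := round (a - b) with hk
  have h1 : D.H (x, b + k) = D.H (x, b) + k := by simpa using D.isFibreLift_H x b 0 k
  have h2 : ((D.H (x, b) : ℝ) : Circle1) = ((D.H (x, b + k) : ℝ) : Circle1) := by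
    rw [h1]
    exact (coe_eq_coe_iff.2 ⟨k, rfl⟩).symm
  rw [h2, UnitAddCircle.norm_eq]
  refine (dist_coe_le _ _).trans ((hL _ _).trans_eq ?_)
  rw [Prod.dist_eq, dist_self, max_eq_right dist_nonneg, Real.dist_eq, ← hk, sub_sub]

/-- The graph tracks the rotation conjugated by the twisted diffeomorphism: when `Q α ≡ 1 / m`, the
position of an orbit relative to the repelling point runs through a Riemann sum. -/
lemma sum_dist_graph_le {L : ℝ} (hL0 : 0 < L) (hL : ∀ v w, |D.H v - D.H w| ≤ L * dist v w)
    {Q m : ℕ} {c : ℝ} (hc : |c| < 1) {α : ℝ} {l : ℤ} (hα : Q * α = l + 1 / m) {C : ℝ}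
    (hC : ∀ u : ℝ, ∑ i ∈ Finset.range m, ‖((mob c (-(u + i / m)) : ℝ) : Circle1)‖ ≤ m * (C / L))
    (z : Torus2) :
    ∑ i ∈ Finset.range m, dist (((D.comp (twist Q c hc)).skewMap α)^[i] z).2
      (D.graph Q (((D.comp (twist Q c hc)).skewMap α)^[i] z).1) ≤ m * C := by
  set E := D.comp (twist Q c hc) with hE
  obtain ⟨⟨x, y⟩, rfl⟩ := torusProj_surjective z
  obtain ⟨w, rfl⟩ : ∃ w, y = E.H (x, w) := ⟨_, (E.H_K x y).symm⟩
  calc _ ≤ ∑ i ∈ Finset.range m, L * ‖((mob c (-((Q * x - w) + i / m)) : ℝ) : Circle1)‖ := ?_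
    _ ≤ L * (m * (C / L)) := by
        rw [← Finset.mul_sum]
        gcongr
        exact hC _
    _ = m * C := by field_simp
  refine Finset.sum_le_sum fun i _ => ?_
  rw [iterate_skewMap]
  set x' := x + i * α with hx'
  have h1 := D.dist_H_le hL x' (Q * x' + mob c (w - Q * x')) (Q * x')
  have h2 : w - Q * x' = -((Q * x - w) + i / m) + ((-(i * l) : ℤ) : ℝ) := by
    push_cast
    rw [hx', mul_add, mul_left_comm, hα]
    ring
  rw [add_sub_cancel_left] at h1
  refine h1.trans_eq ?_
  rw [h2, mob_add_int]
  congr 2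
  exact coe_eq_coe_iff.2 ⟨_, rfl⟩

end FibreDiffeo

/-! ### One step of the approximation by conjugation -/

lemma exists_continuous_iterate {X : Type*} [TopologicalSpace X] [LocallyCompactSpace X] (i : ℕ) :
    ∃ F : C(X, X) → C(X, X), Continuous F ∧ ∀ ψ x, F ψ x = ψ^[i] x := by
  induction i with
  | zero => exact ⟨fun _ => ContinuousMap.id X, continuous_const, fun _ _ => rfl⟩
  | succ i ih =>
    obtain ⟨F, hF, h⟩ := ih
    exact ⟨fun ψ => (F ψ).comp ψ, hF.compCM continuous_id, fun ψ x => h ψ (ψ x)⟩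

/-- Tracking by a graph is stable under perturbations of the map. -/
lemma exists_forall_dist_le_sum_le {ψ₀ : C(Torus2, Torus2)} {g : C(Circle1, Circle1)} {C C' : ℝ}
    {N : ℕ} (hC : C < C')
    (h : ∀ z, ∑ i ∈ Finset.range N, dist (ψ₀^[i] z).2 (g (ψ₀^[i] z).1) ≤ C) :
    ∃ η > 0, ∀ ψ : C(Torus2, Torus2), dist ψ ψ₀ ≤ η →
      ∀ z, ∑ i ∈ Finset.range N, dist (ψ^[i] z).2 (g (ψ^[i] z).1) ≤ C' := by
  choose F hF hFψ using fun i => exists_continuous_iterate (X := Torus2) i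
  set d : C(Torus2, ℝ) := ⟨fun z => dist z.2 (g z.1), by fun_prop⟩ with hd
  have hS : Continuous fun ψ : C(Torus2, Torus2) => ∑ i ∈ Finset.range N, d.comp (F i ψ) :=
    continuous_finsetSum _ fun i _ => (ContinuousMap.continuous_postcomp d).comp (hF i)
  have hSz : ∀ ψ z, (∑ i ∈ Finset.range N, d.comp (F i ψ)) z =
      ∑ i ∈ Finset.range N, dist (ψ^[i] z).2 (g (ψ^[i] z).1) := by
    intro ψ z
    rw [ContinuousMap.sum_apply]
    simp [hd, hFψ]
  obtain ⟨η, hη, hηS⟩ := Metric.continuous_iff.1 hS ψ₀ (C' - C) (by linarith)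
  refine ⟨η / 2, by positivity, fun ψ hψ z => ?_⟩
  have h1 := (ContinuousMap.dist_apply_le_dist z).trans_lt (hηS ψ (by linarith))
  rw [hSz, hSz, Real.dist_eq] at h1
  linarith [h z, le_abs_self (∑ i ∈ Finset.range N, dist (ψ^[i] z).2 (g (ψ^[i] z).1) -
    ∑ i ∈ Finset.range N, dist (ψ₀^[i] z).2 (g (ψ₀^[i] z).1))]

/-- A stage of the construction: a rotation by a rational number `α` with denominator `q`, conjugated
by `D`. All later stages, and the limit, will be within the distance `η`. -/
structure Stage where
  D : FibreDiffeo
  q : ℕ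
  α : ℝ
  η : ℝ
  q_pos : 0 < q
  exists_int : ∃ p : ℤ, q * α = p
  η_pos : 0 < η

/-- The stage `t` may follow the stage `s` at the `n`-th step. -/
structure Stage.Next (n : ℕ) (s t : Stage) : Prop where
  dist_α : |t.α - s.α| ≤ s.η / 2
  dist_conj : ∀ v, |t.D.conj t.α v - s.D.conj s.α v| ≤ s.η / 2
  dist_conj_neg : ∀ v, |t.D.conj (-t.α) v - s.D.conj (-s.α) v| ≤ s.η / 2
  iteratedFDeriv_conj : ∀ j ≤ n, ∀ v,
    ‖iteratedFDeriv ℝ j (fun v => t.D.conj t.α v - s.D.conj s.α v) v‖ ≤ (1 / 2) ^ n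
  iteratedFDeriv_conj_neg : ∀ j ≤ n, ∀ v,
    ‖iteratedFDeriv ℝ j (fun v => t.D.conj (-t.α) v - s.D.conj (-s.α) v) v‖ ≤ (1 / 2) ^ n
  η_le : t.η ≤ s.η / 2
  η_lt : t.η < |t.α - s.α|
  η_mul_le : t.η * (t.q * (n + 1)) ≤ 1
  tracking : ∃ (g : C(Circle1, Circle1)) (N : ℕ) (ε : ℝ), 0 < N ∧ 0 < ε ∧
    (∀ z : Torus2, ε ≤ (1 / 2) ^ n * volume.real {x : Circle1 | dist (x, g x) z < (1 / 2) ^ n}) ∧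
    ∀ ψ : C(Torus2, Torus2), dist ψ (t.D.skewMap t.α) ≤ t.η →
      ∀ z, ∑ i ∈ Finset.range N, dist (ψ^[i] z).2 (g (ψ^[i] z).1) ≤ N * ε

/-- A curve that is `r / 2`-dense spends a definite time in all `r`-balls. -/
lemma exists_pos_le_volume {g : C(Circle1, Circle1)} {r : ℝ} (hr : 0 < r)
    (h : ∀ z : Torus2, ∃ x : Circle1, dist (x, g x) z < r / 2) :
    ∃ c > 0, ∀ z : Torus2, c ≤ volume.real {x : Circle1 | dist (x, g x) z < r} := by
  obtain ⟨δ, hδ, hgδ⟩ := Metric.uniformContinuous_iff.1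
    (CompactSpace.uniformContinuous_of_continuous
      (by fun_prop : Continuous fun x : Circle1 => (x, g x))) (r / 2) (by positivity)
  refine ⟨volume.real (Metric.ball (0 : Circle1) δ), ?_, fun z => ?_⟩
  · exact ENNReal.toReal_pos (Metric.measure_ball_pos volume _ hδ).ne' (measure_ne_top _ _)
  · obtain ⟨x, hx⟩ := h z
    have h1 : volume (Metric.ball (0 : Circle1) δ) = volume (Metric.ball x δ) := by
      rw [← measure_preimage_add_right volume x (Metric.ball x δ)]
      congr 1
      ext y
      simp [Metric.mem_ball, dist_eq_norm]
    rw [measureReal_def, h1]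
    refine measureReal_mono fun y hy => ?_
    have h2 := hgδ (Metric.mem_ball.1 hy)
    have h3 := dist_triangle (y, g y) (x, g x) z
    simp only [Set.mem_ofPred_eq]
    linarith

lemma eventually_sum_norm_mob_le {c : ℝ} (hc : |c| < 1) {C : ℝ}
    (hC : ∫ u in (0 : ℝ)..1, ‖((mob c u : ℝ) : Circle1)‖ < C) :
    ∀ᶠ m : ℕ in atTop, ∀ u : ℝ,
      ∑ i ∈ Finset.range m, ‖((mob c (-(u + i / m)) : ℝ) : Circle1)‖ ≤ m * C := by
  have hper : Function.Periodic (fun u => ‖((mob c u : ℝ) : Circle1)‖) 1 := by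
    intro u
    have := mob_add_int c u 1
    simp only [Int.cast_one] at this
    simp [this]
  have hper' : Function.Periodic (fun u => ‖((mob c (-u) : ℝ) : Circle1)‖) 1 := by
    intro u
    have := hper.neg (-u)
    simpa [add_comm] using this
  have hcont : Continuous (mob c) := (contDiff_mob hc).continuous
  have hcont' : Continuous fun u => ‖((mob c (-u) : ℝ) : Circle1)‖ :=
    (continuous_coe_circle.comp (hcont.comp continuous_neg)).norm
  refine eventually_sum_le_of_periodic hcont' hper' ?_
  rw [intervalIntegral.integral_comp_neg (fun u => ‖((mob c u : ℝ) : Circle1)‖)]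
  have := hper.intervalIntegral_add_eq (-1) 0
  simp only [neg_add_cancel, zero_add] at this
  rwa [neg_zero, this]

/-- Every stage has a successor. The frequency `Q` of the twist, then its strength `c` and last the
denominator of the new rotation number are chosen. -/
lemma Stage.exists_next (n : ℕ) (s : Stage) : ∃ t, Stage.Next n s t := by
  set r : ℝ := (1 / 2) ^ n with hr
  have hr0 : 0 < r := by positivity
  obtain ⟨Q, hQ, ⟨k, hk⟩, hdense⟩ := s.D.exists_graph_dense s.q_pos (half_pos hr0)
  obtain ⟨c₀, hc₀, hvol⟩ := exists_pos_le_volume hr0 hdense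
  obtain ⟨L, hL0, hL⟩ := s.D.isFibreLift_H.exists_lipschitz s.D.contDiff_H
  set ε := r * c₀ with hε
  have hε0 : 0 < ε := by positivity
  obtain ⟨c, hc, hcint⟩ := exists_integral_norm_mob_lt (show 0 < (ε / 2) / L by positivity)
  set E := s.D.comp (FibreDiffeo.twist Q c hc) with hE
  obtain ⟨p, hp⟩ := s.exists_int
  have hQα : (Q : ℝ) * s.α = ((k * p : ℤ) : ℝ) := by
    rw [hk]
    push_cast
    rw [← hp]
    ring
  have hconj : E.conj s.α = s.D.conj s.α := s.D.conj_comp_twist hc hQα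
  have hconj' : E.conj (-s.α) = s.D.conj (-s.α) :=
    s.D.conj_comp_twist hc (l := -(k * p)) (by push_cast; push_cast at hQα; rw [← hQα]; ring)
  have hQ0 : (0 : ℝ) < Q := by exact_mod_cast hQ
  have hη := s.η_pos
  -- The new rotation number, depending on `m`.
  set a : ℕ → ℝ := fun m => s.α + 1 / (Q * m) with ha
  have hat : Tendsto a atTop (𝓝 s.α) := by
    have h1 : Tendsto (fun m : ℕ => s.α + 1 / (Q * m : ℝ)) atTop (𝓝 (s.α + 0)) :=
      tendsto_const_nhds.add (tendsto_const_nhds.div_atTop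
        (tendsto_natCast_atTop_atTop.const_mul_atTop hQ0))
    rwa [add_zero] at h1
  have hsmall : ∀ {δ : ℝ}, 0 < δ → ∀ j : ℕ, ∀ᶠ m in atTop, ∀ v,
      ‖iteratedFDeriv ℝ j (fun v => E.conj (a m) v - s.D.conj s.α v) v‖ ≤ δ := by
    intro δ hδ j
    rw [← hconj]
    exact hat.eventually (eventually_norm_iteratedFDeriv_sub_le E.contDiff_conj_uncurry
      E.isFibreLift_conj s.α j hδ)
  have hsmall' : ∀ {δ : ℝ}, 0 < δ → ∀ j : ℕ, ∀ᶠ m in atTop, ∀ v,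
      ‖iteratedFDeriv ℝ j (fun v => E.conj (-a m) v - s.D.conj (-s.α) v) v‖ ≤ δ := by
    intro δ hδ j
    rw [← hconj']
    exact hat.neg.eventually (eventually_norm_iteratedFDeriv_sub_le E.contDiff_conj_uncurry
      E.isFibreLift_conj (-s.α) j hδ)
  obtain ⟨m, hm0, hsum, haα, hC0, hC0', hCn, hCn'⟩ :=
    ((eventually_gt_atTop 0).and ((eventually_sum_norm_mob_le hc hcint).and
      ((Metric.tendsto_nhds.1 hat (s.η / 2) (half_pos hη)).and
      ((hsmall (half_pos hη) 0).and ((hsmall' (half_pos hη) 0).and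
      (((eventually_all_finset (Finset.range (n + 1))).2 fun j _ => hsmall hr0 j).and
      ((eventually_all_finset (Finset.range (n + 1))).2 fun j _ => hsmall' hr0 j))))))).exists
  have hm : (0 : ℝ) < m := by exact_mod_cast hm0
  have hQa : (Q : ℝ) * a m = ((k * p : ℤ) : ℝ) + 1 / m := by
    rw [ha]
    simp only
    rw [mul_add, hQα]
    field_simp
  have htrack := s.D.sum_dist_graph_le hL0 hL hc hQa hsum
  obtain ⟨η, hη0, hηψ⟩ := exists_forall_dist_le_sum_le
    (show (m : ℝ) * (ε / 2) < m * ε by nlinarith) htrack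
  have hdiff : a m - s.α = 1 / (Q * m) := by simp [ha]
  have hη1 : (0 : ℝ) < 1 / ((Q * m : ℕ) * (n + 1)) := by push_cast; positivity
  refine ⟨⟨E, Q * m, a m, min (min η (s.η / 2)) (min (1 / (Q * m) / 2)
    (1 / ((Q * m : ℕ) * (n + 1)))), Nat.mul_pos hQ hm0, ⟨m * (k * p) + 1, ?_⟩, by positivity⟩, ?_⟩
  · push_cast at hQa ⊢
    rw [mul_right_comm, hQa]
    field_simp
  constructor
  · have := haα.le
    rwa [Real.dist_eq] at this
  · intro v
    have := hC0 v
    rwa [norm_iteratedFDeriv_zero, Real.norm_eq_abs] at this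
  · intro v
    have := hC0' v
    rwa [norm_iteratedFDeriv_zero, Real.norm_eq_abs] at this
  · exact fun j hj => hCn j (Finset.mem_range.2 (Nat.lt_succ_of_le hj))
  · exact fun j hj => hCn' j (Finset.mem_range.2 (Nat.lt_succ_of_le hj))
  · exact (min_le_left _ _).trans (min_le_right _ _)
  · simp only
    have h1 : (0 : ℝ) < 1 / (Q * m) := by positivity
    rw [hdiff, abs_of_pos h1]
    exact ((min_le_right _ _).trans (min_le_left _ _)).trans_lt (half_lt_self h1)
  · simp only
    rw [← le_div_iff₀ (by push_cast; positivity)]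
    exact (min_le_right _ _).trans (min_le_right _ _)
  · refine ⟨s.D.graph Q, m, ε, hm0, hε0, fun z => ?_, fun ψ hψ => ?_⟩
    · rw [hε]
      gcongr
      exact hvol z
    · exact hηψ ψ (hψ.trans ((min_le_left _ _).trans (min_le_left _ _)))

/-! ### The limit -/

section Limits

variable {η : ℕ → ℝ}

lemma tendsto_zero_of_le_half (h0 : ∀ n, 0 < η n) (h : ∀ n, η (n + 1) ≤ η n / 2) :
    Tendsto η atTop (𝓝 0) := by
  have h1 : ∀ n, η n ≤ η 0 * (1 / 2) ^ n := by
    intro n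
    induction n with
    | zero => simp
    | succ n ih =>
      rw [pow_succ]
      linarith [h n]
  refine squeeze_zero (fun n => (h0 n).le) h1 ?_
  have := (tendsto_pow_atTop_nhds_zero_of_lt_one (r := (1 / 2 : ℝ)) (by norm_num)
    (by norm_num)).const_mul (η 0)
  rwa [mul_zero] at this

lemma exists_tendsto_of_le_half (h0 : ∀ n, 0 < η n) (h : ∀ n, η (n + 1) ≤ η n / 2) {u : ℕ → ℝ}
    (hu : ∀ n, |u (n + 1) - u n| ≤ η n / 2) :
    ∃ l, Tendsto u atTop (𝓝 l) ∧ ∀ n, |l - u n| ≤ η n := by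
  have h1 : ∀ n k, |u (n + k) - u n| ≤ η n - η (n + k) := by
    intro n k
    induction k with
    | zero => simp
    | succ k ih =>
      have h2 := abs_sub_le (u (n + (k + 1))) (u (n + k)) (u n)
      have h3 := hu (n + k)
      have h4 := h (n + k)
      rw [add_assoc] at h3 h4
      linarith
  have h2 : ∀ n k, |u (n + k) - u n| ≤ η n := fun n k => by
    linarith [h1 n k, h0 (n + k)]
  have hc : CauchySeq u := by
    refine cauchySeq_of_le_tendsto_0' η (fun n m hnm => ?_) (tendsto_zero_of_le_half h0 h)
    obtain ⟨k, rfl⟩ := Nat.exists_eq_add_of_le hnm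
    rw [dist_comm]
    exact h2 n k
  obtain ⟨l, hl⟩ := cauchySeq_tendsto_of_complete hc
  refine ⟨l, hl, fun n => ?_⟩
  have h3 : Tendsto (fun k => |u (n + k) - u n|) atTop (𝓝 |l - u n|) := by
    have h4 : Tendsto (fun k => u (n + k)) atTop (𝓝 l) := by
      simpa only [add_comm n] using (tendsto_add_atTop_iff_nat n).2 hl
    exact (h4.sub_const _).abs
  exact le_of_tendsto' h3 (h2 n)

lemma tendsto_apply_of_uniform {X : Type*} [TopologicalSpace X] {f : X → ℝ} {F : ℕ → X → ℝ}
    (hη : Tendsto η atTop (𝓝 0)) (hF : ∀ n v, |f v - F n v| ≤ η n) (hf : Continuous f)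
    {w : ℕ → X} {v : X} (hw : Tendsto w atTop (𝓝 v)) :
    Tendsto (fun n => F n (w n)) atTop (𝓝 (f v)) := by
  have h1 : Tendsto (fun n => f (w n) - F n (w n)) atTop (𝓝 0) :=
    squeeze_zero_norm (fun n => hF n (w n)) hη
  have h2 := ((hf.tendsto v).comp hw).sub h1
  simpa using h2

end Limits

/-- A limit of smooth functions is smooth if the derivatives of all orders converge geometrically. -/
lemma contDiff_of_tendsto {E : Type*} [NormedAddCommGroup E] [NormedSpace ℝ E]
    {F : ℕ → E → ℝ} {f : E → ℝ} (hF : ∀ n, ContDiff ℝ ∞ (F n))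
    (hb : ∀ n, ∀ j ≤ n, ∀ v,
      ‖iteratedFDeriv ℝ j (fun v => F (n + 1) v - F n v) v‖ ≤ (1 / 2) ^ n)
    (hlim : ∀ v, Tendsto (fun n => F n v) atTop (𝓝 (f v))) : ContDiff ℝ ∞ f := by
  have hsum : ∀ v, f v = F 0 v + ∑' n, (F (n + 1) v - F n v) := by
    intro v
    have hs : Summable fun n => F (n + 1) v - F n v := by
      refine Summable.of_norm_bounded summable_geometric_two fun n => ?_
      have := hb n 0 (Nat.zero_le n) v
      rwa [norm_iteratedFDeriv_zero] at this
    have h1 := hs.hasSum.tendsto_sum_nat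
    simp only [Finset.sum_range_sub (fun n => F n v)] at h1
    have h2 := tendsto_nhds_unique h1 ((hlim v).sub_const _)
    rw [h2]
    ring
  rw [funext hsum]
  refine (hF 0).add (contDiff_tsum_of_eventually (v := fun _ n => (1 / 2 : ℝ) ^ n)
    (fun n => (hF (n + 1)).sub (hF n)) (fun _ _ => summable_geometric_two) fun k _ => ?_)
  rw [Nat.cofinite_eq_atTop]
  filter_upwards [eventually_ge_atTop k] with n hn v using hb n k hn v

/-- The homeomorphism of the torus given by lifts of it and of its inverse. -/
noncomputable def skewHomeo {f f' : ℝ × ℝ → ℝ} (hf : IsFibreLift f) (hf' : IsFibreLift f')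
    (hc : Continuous f) (hc' : Continuous f') (α : ℝ) (h : ∀ v, f' (v.1 + α, f v) = v.2)
    (h' : ∀ v, f (v.1 - α, f' v) = v.2) : Torus2 ≃ₜ Torus2 where
  toFun := skewFun α f
  invFun := skewFun (-α) f'
  left_inv := by
    intro z
    obtain ⟨v, rfl⟩ := torusProj_surjective z
    rw [skewFun_torusProj hf, skewFun_torusProj hf', h, add_neg_cancel_right]
  right_inv := by
    intro z
    obtain ⟨v, rfl⟩ := torusProj_surjective z
    rw [skewFun_torusProj hf', skewFun_torusProj hf, ← sub_eq_add_neg, h', sub_add_cancel]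
  continuous_toFun := continuous_skewFun hf hc α
  continuous_invFun := continuous_skewFun hf' hc' (-α)

/-- The initial stage: the identity. -/
def Stage.init : Stage := ⟨.refl, 1, 0, 1, one_pos, ⟨0, by simp⟩, one_pos⟩

lemma exists_stages : ∃ S : ℕ → Stage, ∀ n, Stage.Next n (S n) (S (n + 1)) := by
  choose next hnext using Stage.exists_next
  exact ⟨fun n => Nat.rec Stage.init next n, fun n => hnext n _⟩

/-- Rotation numbers that are approximated well by rationals, without being equal to them, are
irrational. -/
lemma irrational_of_approx {α : ℝ} (h : ∀ n : ℕ, ∃ (q : ℕ) (p : ℤ) (a : ℝ), 0 < q ∧ q * a = p ∧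
    α ≠ a ∧ |α - a| * (q * (n + 1)) ≤ 1) : Irrational α := by
  rintro ⟨x, rfl⟩
  obtain ⟨q, p, a, hq, hqa, hne, hle⟩ := h x.den
  have hq0 : (0 : ℝ) < q := by exact_mod_cast hq
  have hd0 : (0 : ℝ) < x.den := by exact_mod_cast x.den_pos
  have hx : (x : ℝ) * x.den = x.num := by exact_mod_cast Rat.mul_den_eq_num x
  have h1 : (x - a) * (q * x.den) = ((x.num * q - p * x.den : ℤ) : ℝ) := by
    push_cast
    rw [← hx, ← hqa]
    ring
  have h2 : (x.num * q - p * x.den : ℤ) ≠ 0 := by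
    intro h0
    rw [h0, Int.cast_zero, mul_eq_zero] at h1
    rcases h1 with h1 | h1
    · exact hne (sub_eq_zero.1 h1)
    · exact (by positivity : (q * x.den : ℝ) ≠ 0) h1
  have h3 : (1 : ℝ) ≤ |(x - a : ℝ)| * (q * x.den) := by
    rw [← abs_of_pos (by positivity : (0 : ℝ) < q * x.den), ← abs_mul, h1]
    exact_mod_cast Int.one_le_abs h2
  have h4 : 0 < |(x - a : ℝ)| := abs_pos.2 (sub_ne_zero.2 hne)
  nlinarith [mul_pos h4 hq0]

instance : Nontrivial Circle1 := by
  refine ⟨((1 / 2 : ℝ) : Circle1), ((0 : ℝ) : Circle1), fun h => ?_⟩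
  obtain ⟨n, hn⟩ := coe_eq_coe_iff.1 h
  have h1 : (1 : ℝ) = ((2 * n : ℤ) : ℝ) := by
    push_cast
    linarith
  have h2 : (1 : ℤ) = 2 * n := by exact_mod_cast h1
  omega

/-- The limit of the stages. -/
lemma exists_smooth_skew_product : ∃ (φ : Torus2 ≃ₜ Torus2) (α : ℝ), IsSmoothTorusDiffeo φ ∧
    Irrational α ∧ (∀ z, (φ z).1 = z.1 + (α : Circle1)) ∧ HasDenseTrackingGraphs φ := by
  obtain ⟨S, hS⟩ := exists_stages
  have hη0 : ∀ n, 0 < (S n).η := fun n => (S n).η_pos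
  have hη1 : ∀ n, (S (n + 1)).η ≤ (S n).η / 2 := fun n => (hS n).η_le
  have hη := tendsto_zero_of_le_half hη0 hη1
  set F : ℕ → ℝ × ℝ → ℝ := fun n => (S n).D.conj (S n).α with hF
  set F' : ℕ → ℝ × ℝ → ℝ := fun n => (S n).D.conj (-(S n).α) with hF'
  obtain ⟨α, hα, hαn⟩ := exists_tendsto_of_le_half (u := fun n => (S n).α) hη0 hη1
    fun n => (hS n).dist_α
  have hlim : ∀ v, ∃ l, Tendsto (fun n => F n v) atTop (𝓝 l) ∧ ∀ n, |l - F n v| ≤ (S n).η :=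
    fun v => exists_tendsto_of_le_half hη0 hη1 fun n => (hS n).dist_conj v
  have hlim' : ∀ v, ∃ l, Tendsto (fun n => F' n v) atTop (𝓝 l) ∧ ∀ n, |l - F' n v| ≤ (S n).η :=
    fun v => exists_tendsto_of_le_half hη0 hη1 fun n => (hS n).dist_conj_neg v
  choose f hf hfn using hlim
  choose f' hf' hfn' using hlim'
  have hfs : ContDiff ℝ ∞ f := contDiff_of_tendsto (F := F) (fun n => (S n).D.contDiff_conj _)
    (fun n => (hS n).iteratedFDeriv_conj) hf
  have hfs' : ContDiff ℝ ∞ f' := contDiff_of_tendsto (F := F') (fun n => (S n).D.contDiff_conj _)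
    (fun n => (hS n).iteratedFDeriv_conj_neg) hf'
  have hfl : IsFibreLift f := fun x y m n => by
    refine tendsto_nhds_unique (hf _) ?_
    simp only [hF, (S _).D.isFibreLift_conj _ x y m n]
    exact (hf _).add_const _
  have hfl' : IsFibreLift f' := fun x y m n => by
    refine tendsto_nhds_unique (hf' _) ?_
    simp only [hF', (S _).D.isFibreLift_conj _ x y m n]
    exact (hf' _).add_const _
  have hinv : ∀ v : ℝ × ℝ, f' (v.1 + α, f v) = v.2 := by
    rintro ⟨x, y⟩
    have h1 := tendsto_apply_of_uniform (F := F') hη (fun n v => hfn' v n) hfs'.continuous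
      ((hα.const_add x).prodMk_nhds (hf (x, y)))
    simp only [hF, hF', FibreDiffeo.conj_conj, add_neg_cancel, FibreDiffeo.conj_zero] at h1
    exact (tendsto_nhds_unique h1 tendsto_const_nhds)
  have hinv' : ∀ v : ℝ × ℝ, f (v.1 - α, f' v) = v.2 := by
    rintro ⟨x, y⟩
    have h1 := tendsto_apply_of_uniform (F := F) hη (fun n v => hfn v n) hfs.continuous
      ((hα.neg.const_add x).prodMk_nhds (hf' (x, y)))
    simp only [hF, hF', FibreDiffeo.conj_conj, neg_add_cancel, FibreDiffeo.conj_zero] at h1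
    rw [← sub_eq_add_neg] at h1
    exact (tendsto_nhds_unique h1 tendsto_const_nhds)
  set φ := skewHomeo hfl hfl' hfs.continuous hfs'.continuous α hinv hinv' with hφ
  have hφv : ∀ v, φ (torusProj v) = torusProj (v.1 + α, f v) := skewFun_torusProj hfl α
  have hφv' : ∀ v, φ.symm (torusProj v) = torusProj (v.1 + -α, f' v) :=
    skewFun_torusProj hfl' (-α)
  refine ⟨φ, α, ⟨⟨fun v => (v.1 + α, f v), by fun_prop, hφv⟩,
    ⟨fun v => (v.1 + -α, f' v), by fun_prop, hφv'⟩⟩, ?_, ?_, ?_⟩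
  · refine irrational_of_approx fun n => ?_
    obtain ⟨p, hp⟩ := (S (n + 1)).exists_int
    refine ⟨(S (n + 1)).q, p, (S (n + 1)).α, (S (n + 1)).q_pos, hp, ?_, ?_⟩
    · rintro rfl
      have h1 := hαn (n + 1 + 1)
      rw [abs_sub_comm] at h1
      exact absurd (hS (n + 1)).η_lt (not_lt.2 h1)
    · refine le_trans ?_ (hS n).η_mul_le
      gcongr
      exact hαn (n + 1)
  · intro z
    obtain ⟨v, rfl⟩ := torusProj_surjective z
    rw [hφv]
    rfl
  · intro r hr
    obtain ⟨n, hn⟩ := exists_pow_lt_of_lt_one hr (by norm_num : (1 / 2 : ℝ) < 1)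
    obtain ⟨g, N, ε, hN, hε, hvol, htrack⟩ := (hS n).tracking
    refine ⟨g, ε, hε, ⟨N, hN, fun z => ?_⟩, fun z => (hvol z).trans ?_⟩
    · have h1 := htrack ⟨φ, φ.continuous⟩ ((ContinuousMap.dist_le (hη0 _).le).2 fun z =>
        dist_skewFun_le hfl ((S (n + 1)).D.isFibreLift_conj _) (hαn (n + 1))
          (fun v => hfn v (n + 1)) z) z
      simp only [homeomorph_pow_apply]
      exact h1
    · exact mul_le_mul hn.le (measureReal_mono fun x hx => lt_trans hx hn) measureReal_nonneg hr.le

end TDS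


theorem theorem1 :
    ∃ (φ : TDS.Torus2 ≃ₜ TDS.Torus2) (α : ℝ),
      TDS.IsSmoothTorusDiffeo φ ∧
      -- skew product over an irrational rotation
      Irrational α ∧ TDS.IsSkewProductOver φ (TDS.circleRotation α) ∧
      -- dynamics and maximal equicontinuous factor
      TDS.IsTotallyStrictlyErgodic φ ∧
      TDS.IsMeanEquicontinuous φ ∧
      TDS.IsMaximalEquicontinuousFactor φ (TDS.circleRotation α) Prod.fst ∧
      -- all fibres of the factor map are circles, and there are no injectivity points
      (∀ x : TDS.Circle1,
        Nonempty ((Prod.fst ⁻¹' {x} : Set TDS.Torus2) ≃ₜ TDS.Circle1)) ∧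
      (∀ z : TDS.Torus2, (Prod.fst ⁻¹' {z.1} : Set TDS.Torus2) ≠ {z}) ∧
      -- the unique invariant measure is carried by a measurable graph
      ∃ γ : TDS.Circle1 → TDS.Circle1, Measurable γ ∧
        TDS.IsUniqueInvariantMeasure φ
          (Measure.map (fun x : TDS.Circle1 => (x, γ x)) volume) := by
  obtain ⟨φ, α, hsmooth, hα, hβ, h⟩ := TDS.exists_smooth_skew_product
  refine ⟨φ, α, hsmooth, hα, ⟨fun x y => (φ (x, y)).2, fun x y => Prod.ext (hβ _) rfl⟩,
    TDS.isTotallyStrictlyErgodic_of_tracking hβ hα h, TDS.isMeanEquicontinuous_of_tracking hβ h,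
    TDS.isMaximalEquicontinuousFactor_of_tracking hβ h, fun x => ⟨?_⟩, fun z hz => ?_, ?_⟩
  · exact
      { toFun := fun z => z.1.2
        invFun := fun y => ⟨(x, y), rfl⟩
        left_inv := fun ⟨⟨a, b⟩, hab⟩ => Subtype.ext (Prod.ext (Eq.symm hab) rfl)
        right_inv := fun _ => rfl
        continuous_toFun := by fun_prop
        continuous_invFun := by fun_prop }
  · obtain ⟨y, hy⟩ := exists_ne z.2
    have h1 : (z.1, y) ∈ (Prod.fst ⁻¹' {z.1} : Set TDS.Torus2) := rfl
    rw [hz] at h1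
    exact hy (congrArg Prod.snd h1)
  · obtain ⟨γ, hγ, hμ⟩ := TDS.exists_graph_measure hβ hα h
    exact ⟨γ, hγ, by simpa only [pow_one] using hμ 1 one_pos⟩
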